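/- Let $M^m$ be a smooth Riemannian manifold, $\mathbb S^{m+1}\subset\mathbb R^{m+2}$ the round unit sphere, and $\phi\colon M^m\to\mathbb S^{m+1}$ a biharmonic hypersurface, i.e. a smooth isometric immersion whose bitension field $$\tau_2(\phi)=-\bar\Delta\tau(\phi)-\operatorname{Tr}_g R^{\mathbb S^{m+1}}(d\phi(\cdot),\tau(\phi))\,d\phi(\cdot)$$ vanishes. Here $\bar\nabla$ is the connection on $\phi^*T\mathbb S^{m+1}$, $\tau(\phi)=\operatorname{Tr}_g\bar\nabla d\phi$ is the tension field, $\bar\Delta=-\operatorname{Tr}_g(\bar\nabla\bar\nabla-\bar\nabla_\nabla)$, and $R(Y,Z)W=\nabla_Y\nabla_ZW-\nabla_Z\nabla_YW-\nabla_{[Y,Z]}W$. Let $\nu$ be a smooth global unit normal field of the hypersurface, $A$ its shape operator, given by $d\phi(A(U))=-\bar\nabla_U\nu$, and $f=\frac1m\operatorname{Tr}A$ its mean curvature function. Then for every smooth Killing vector field $X$ on $\mathbb S^{m+1}$ the vector field $$J^{2,hyp}(\phi)=mf\,\langle\bar\nabla(X\circ\phi),\nu\rangle^\sharp+mf\,\langle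 X\circ\phi,d\phi(A(\cdot))\rangle^\sharp-m\,\langle X\circ\phi,\nu\rangle\operatorname{grad}f$$ on $M$ is smooth and divergence-free. -/

import Mathlib

open Bundle
open scoped Manifold ContDiff Bundle RealInnerProductSpace

noncomputable section

namespace BiharmonicHypersurface

/-! ### The round unit sphere

Tangent vectors of the unit sphere are written as vectors of the ambient Euclidean space, via the
differential of the inclusion; the round metric is the ambient inner product. -/

/-- The Euclidean space `ℝ ^ (n + 1)` that contains the `n`-sphere. -/
abbrev Ambient (n : ℕ) : Type := EuclideanSpace ℝ (Fin (n + 1))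

/-- The unit sphere `S ^ n`, with Mathlib's smooth structure. -/
abbrev Sph (n : ℕ) : Type := Metric.sphere (0 : Ambient n) 1

/-- The component of `w` orthogonal to `x`. For `|x| = 1` this is the orthogonal projection of the
ambient space onto the tangent space of the unit sphere at `x`. -/
def tanProj {n : ℕ} (x w : Ambient n) : Ambient n := w - ⟪x, w⟫ • x

/-- A vector field on the sphere, written as a map into the ambient space. -/
def toAmbient {n : ℕ} (X : ∀ x : Sph n, TangentSpace (𝓡 n) x) (x : Sph n) : Ambient n :=
  mvfderiv (𝓡 n) (fun y : Sph n => (y : Ambient n)) x (X x)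

/-- The Levi-Civita connection `∇_v X` of the round sphere: the tangential component of the
ambient derivative. -/
def sphereConn {n : ℕ} (X : ∀ x : Sph n, TangentSpace (𝓡 n) x) (x : Sph n)
    (v : TangentSpace (𝓡 n) x) : Ambient n :=
  tanProj (x : Ambient n) (mvfderiv (𝓡 n) (toAmbient X) x v)

/-- `X` is a (smooth) Killing vector field on the round sphere:
`⟨∇_v X, w⟩ + ⟨∇_w X, v⟩ = 0` for all tangent vectors `v`, `w` at the same point. -/
structure IsKilling {n : ℕ} (X : ∀ x : Sph n, TangentSpace (𝓡 n) x) : Prop where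
  smooth : ContMDiff (𝓡 n) (𝓡 n).tangent ∞ (fun x => (⟨x, X x⟩ : TangentBundle (𝓡 n) (Sph n)))
  killing : ∀ (x : Sph n) (v w : TangentSpace (𝓡 n) x),
    ⟪sphereConn X x v, mvfderiv (𝓡 n) (fun y : Sph n => (y : Ambient n)) x w⟫ +
      ⟪sphereConn X x w, mvfderiv (𝓡 n) (fun y : Sph n => (y : Ambient n)) x v⟫ = 0

/-- For `W : ℝ ^ (n + 1) → ℝ ^ (n + 1)` tangent to the unit sphere along it and `u` tangent at `x`,
this is `∇_u W` at `x` for the Levi-Civita connection of the sphere. -/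
def ambConn {n : ℕ} (W : Ambient n → Ambient n) (x u : Ambient n) : Ambient n :=
  tanProj x (fderiv ℝ W x u)

/-- The curvature tensor of the round sphere at a point `x`, applied to tangent vectors `a b c`,
with the sign convention `R(Y, Z) W = ∇_Y ∇_Z W - ∇_Z ∇_Y W - ∇_[Y, Z] W`. The tangent vector `a`
is extended to the tangent vector field `y ↦ tanProj y a`, likewise `b` and `c`. -/
def sphereCurvature {n : ℕ} (x a b c : Ambient n) : Ambient n :=
  let A : Ambient n → Ambient n := fun y => tanProj y a
  let B : Ambient n → Ambient n := fun y => tanProj y b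
  let C : Ambient n → Ambient n := fun y => tanProj y c
  ambConn (fun y => ambConn C y (B y)) x (A x) - ambConn (fun y => ambConn C y (A y)) x (B x) -
    ambConn C x (fderiv ℝ B x (A x) - fderiv ℝ A x (B x))

/-! ### Riemannian geometry of the domain -/

section Domain

variable {m : ℕ} {M : Type*} [TopologicalSpace M] [ChartedSpace (EuclideanSpace ℝ (Fin m)) M]
  [IsManifold (𝓡 m) ∞ M]

/-- The local vector field with value `v` at `p` whose components in the preferred chart at `p` are
constant (on the domain of that chart). -/
def coordField (p : M) (v : TangentSpace (𝓡 m) p) (q : M) : TangentSpace (𝓡 m) q :=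
  (trivializationAt (EuclideanSpace ℝ (Fin m)) (TangentSpace (𝓡 m)) p).symmL ℝ q
    ((trivializationAt (EuclideanSpace ℝ (Fin m)) (TangentSpace (𝓡 m)) p).continuousLinearMapAt
      ℝ p v)

variable [RiemannianBundle (fun p : M => TangentSpace (𝓡 m) p)]

instance finiteDimensional_tangentSpace (p : M) :
    FiniteDimensional ℝ (TangentSpace (𝓡 m) p) :=
  inferInstanceAs (FiniteDimensional ℝ (EuclideanSpace ℝ (Fin m)))

/-- An orthonormal basis of the tangent space at `p`. -/
abbrev onb (p : M) :
    OrthonormalBasis (Fin (Module.finrank ℝ (TangentSpace (𝓡 m) p))) ℝ (TangentSpace (𝓡 m) p) :=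
  stdOrthonormalBasis ℝ (TangentSpace (𝓡 m) p)

/-- The musical isomorphism: for a linear form `α` on the tangent space at `p`, the tangent vector
`α♯` with `⟨α♯, w⟩ = α w`. -/
def sharp (p : M) (α : TangentSpace (𝓡 m) p → ℝ) : TangentSpace (𝓡 m) p :=
  ∑ i, α (onb p i) • onb p i

/-- The Christoffel symbols in the preferred chart at `p`, evaluated at `p`: with
`U, V, W` the coordinate fields extending `u, v, w`,
`⟨Γ(u, v), w⟩ = (u⟨V, W⟩ + v⟨U, W⟩ - w⟨U, V⟩) / 2`. -/
def christoffel (p : M) (u v : TangentSpace (𝓡 m) p) : TangentSpace (𝓡 m) p :=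
  sharp p fun w =>
    (mvfderiv (𝓡 m) (fun q => ⟪coordField p v q, coordField p w q⟫) p u +
      mvfderiv (𝓡 m) (fun q => ⟪coordField p u q, coordField p w q⟫) p v -
      mvfderiv (𝓡 m) (fun q => ⟪coordField p u q, coordField p v q⟫) p w) / 2

/-- The Levi-Civita connection `∇_u Y` at `p`: derivative of the components of `Y` in the preferred
chart at `p`, plus the Christoffel term. -/
def leviCivita (Y : ∀ q : M, TangentSpace (𝓡 m) q) (p : M) (u : TangentSpace (𝓡 m) p) :
    TangentSpace (𝓡 m) p :=
  (trivializationAt (EuclideanSpace ℝ (Fin m)) (TangentSpace (𝓡 m)) p).symmL ℝ p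
      (mvfderiv (𝓡 m)
        (fun q => (trivializationAt (EuclideanSpace ℝ (Fin m))
          (TangentSpace (𝓡 m)) p).continuousLinearMapAt ℝ q (Y q)) p u) +
    christoffel p u (Y p)

/-- The divergence: the trace of `u ↦ ∇_u Y`. -/
def divergence (Y : ∀ q : M, TangentSpace (𝓡 m) q) (p : M) : ℝ :=
  ∑ i, ⟪leviCivita Y p (onb p i), onb p i⟫

/-- The gradient of a function. -/
def gradient (f : M → ℝ) (p : M) : TangentSpace (𝓡 m) p :=
  sharp p fun u => mvfderiv (𝓡 m) f p u

/-! ### Maps into the sphere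

Sections of the pull-back bundle `φ^* T S ^ n` are written as maps `W` from `M` to the ambient space
with `⟨φ p, W p⟩ = 0`. -/

variable {n : ℕ}

/-- The differential `dφ` at `p`, with values in the ambient space. -/
def dmap (φ : M → Sph n) (p : M) : TangentSpace (𝓡 m) p →L[ℝ] Ambient n :=
  mvfderiv (𝓡 m) (fun q => (φ q : Ambient n)) p

/-- The pull-back connection on `φ^* T S ^ n`. -/
def pullbackConn (φ : M → Sph n) (W : M → Ambient n) (p : M) (u : TangentSpace (𝓡 m) p) :
    Ambient n :=
  tanProj (φ p : Ambient n) (mvfderiv (𝓡 m) W p u)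

variable (m) in
/-- The tension field `τ(φ) = Tr (∇ dφ)`. -/
def tension (φ : M → Sph n) (p : M) : Ambient n :=
  let e := onb (m := m) p;
  ∑ i, (pullbackConn φ (fun q => dmap φ q (coordField p (e i) q)) p (e i) -
    dmap φ p (leviCivita (coordField p (e i)) p (e i)))

variable (m) in
/-- The rough Laplacian on sections of `φ^* T S ^ n`, with the sign `-Tr (∇ ∇ - ∇_∇)`. -/
def roughLaplacian (φ : M → Sph n) (W : M → Ambient n) (p : M) : Ambient n :=
  let e := onb (m := m) p;
  -∑ i, (pullbackConn φ (fun q => pullbackConn φ W q (coordField p (e i) q)) p (e i) -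
    pullbackConn φ W p (leviCivita (coordField p (e i)) p (e i)))

variable (m) in
/-- The bitension field `τ₂(φ) = -Δ τ(φ) - Tr R(dφ(·), τ(φ)) dφ(·)`, where `Δ` is the rough
Laplacian and `R` the curvature tensor of the sphere. -/
def bitension (φ : M → Sph n) (p : M) : Ambient n :=
  let e := onb (m := m) p;
  -roughLaplacian m φ (tension m φ) p -
    ∑ i, sphereCurvature (φ p : Ambient n) (dmap φ p (e i)) (tension m φ p) (dmap φ p (e i))

variable (m) in
/-- `φ` is a smooth isometric immersion. -/
structure IsIsometricImmersion (φ : M → Sph n) : Prop where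
  smooth : ContMDiff (𝓡 m) (𝓡 n) ∞ φ
  isometric : ∀ (p : M) (u v : TangentSpace (𝓡 m) p), ⟪dmap φ p u, dmap φ p v⟫ = ⟪u, v⟫

/-- `φ` is a biharmonic hypersurface: an isometric immersion of the `m`-dimensional manifold `M`
into `S ^ (m + 1)` that is a biharmonic map. -/
structure IsBiharmonicHypersurface (φ : M → Sph (m + 1)) : Prop extends
    IsIsometricImmersion m φ where
  biharmonic : ∀ p, bitension m φ p = 0

/-- `ν` is a (smooth, global) unit normal field of the hypersurface `φ` in the sphere. -/
structure IsUnitNormal (φ : M → Sph (m + 1)) (ν : M → Ambient (m + 1)) : Prop where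
  smooth : ContMDiff (𝓡 m) 𝓘(ℝ, Ambient (m + 1)) ∞ ν
  tangent_sphere : ∀ p, ⟪(φ p : Ambient (m + 1)), ν p⟫ = 0
  normal : ∀ p (u : TangentSpace (𝓡 m) p), ⟪dmap φ p u, ν p⟫ = 0
  unit : ∀ p, ‖ν p‖ = 1

/-- The shape operator `A`, determined by `dφ (A u) = -∇_u ν`, i.e. by
`⟨A u, w⟩ = -⟨∇_u ν, dφ w⟩` for all `w`. -/
def shapeOperator (φ : M → Sph (m + 1)) (ν : M → Ambient (m + 1)) (p : M)
    (u : TangentSpace (𝓡 m) p) : TangentSpace (𝓡 m) p :=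
  sharp p fun w => -⟪pullbackConn φ ν p u, dmap φ p w⟫

/-- The mean curvature function `f = Tr A / m`. -/
def meanCurvature (φ : M → Sph (m + 1)) (ν : M → Ambient (m + 1)) (p : M) : ℝ :=
  (∑ i, ⟪shapeOperator φ ν p (onb p i), onb p i⟫) / m

/-- The vector field
`m f ⟨∇(X ∘ φ), ν⟩♯ + m f ⟨X ∘ φ, A(·)⟩♯ - m ⟨X ∘ φ, ν⟩ grad f`. -/
def hypCurrent (φ : M → Sph (m + 1)) (ν : M → Ambient (m + 1))
    (X : ∀ x : Sph (m + 1), TangentSpace (𝓡 (m + 1)) x) (p : M) : TangentSpace (𝓡 m) p :=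
  (m * meanCurvature φ ν p) •
      sharp p (fun u => ⟪pullbackConn φ (fun q => toAmbient X (φ q)) p u, ν p⟫) +
    (m * meanCurvature φ ν p) •
      sharp p (fun u => ⟪toAmbient X (φ p), dmap φ p (shapeOperator φ ν p u)⟫) -
    (m * ⟪toAmbient X (φ p), ν p⟫) • gradient (meanCurvature φ ν) p

end Domain

end BiharmonicHypersurface

end

/-! Everything is computed in the ambient space ℝ^(m+2). Write x = φ, H = m f, D for ambient
differentiation along M, and B for minus the derivative of ν precomposed with the tangential
projection. B is symmetric and kills x and ν.

A Killing field of the sphere is the restriction of a skew endomorphism K (`IsKilling.exists_skew`).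
Its extension homogeneous of degree one has a skew derivative away from the origin. The second
derivative is then symmetric in two slots and skew in two others, so it vanishes, and the extension
is linear.

Since τ(φ) = H ν (`tension_eq`), the bitension field paired with Kx is a sum over an orthonormal
frame of terms in H, B and their first and second derivatives (`inner_bitension`). The image of the
current under dφ is H (B K x − K ν − ⟨Kx, ν⟩ x) − ⟨Kx, ν⟩ grad H (`dmap_hypCurrent`), which is
visibly smooth. By the Gauss formula its divergence is the tangential trace of its ambient
derivative (`divergence_eq_sum_inner`).

Expanding by the product rule, and using only that K is skew and that B and DB are symmetric, gives
div J = −⟨τ₂(φ), X ∘ φ⟩ for every isometric hypersurface (`divergence_hypCurrent`). The summands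
agree one by one, so the Codazzi equation is not needed. Biharmonicity makes the right side vanish.
-/

noncomputable section

namespace BiharmonicHypersurface

/-! ### Differential calculus in a preferred chart -/

section ChartCalculus

variable {m : ℕ} {M : Type*} [TopologicalSpace M] [ChartedSpace (EuclideanSpace ℝ (Fin m)) M]
  {V W Z : Type*} [NormedAddCommGroup V] [NormedSpace ℝ V] [NormedAddCommGroup W] [NormedSpace ℝ W]
  [NormedAddCommGroup Z] [NormedSpace ℝ Z]

/-- The derivative at `q` of `G` read in the preferred chart at `p`. -/
def chartFDeriv (G : M → V) (p q : M) : EuclideanSpace ℝ (Fin m) →L[ℝ] V :=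
  fderiv ℝ (G ∘ (extChartAt (𝓡 m) p).symm) (extChartAt (𝓡 m) p q)

/-- The chain rule for a manifold derivative followed by a map of normed spaces. -/
theorem mvfderiv_comp_left {h : V → W} {f : M → V} {p : M} {h' : V →L[ℝ] W}
    (hh : HasFDerivAt h h' (f p)) (hf : MDifferentiableAt (𝓡 m) 𝓘(ℝ, V) f p)
    (u : TangentSpace (𝓡 m) p) :
    mvfderiv (𝓡 m) (fun q => h (f q)) p u = h' (mvfderiv (𝓡 m) f p u) := by
  have := (hh.hasMFDerivAt.comp p hf.hasMFDerivAt).mfderiv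
  exact congrArg (fun L => L u) this

theorem mvfderiv_bilinear (β : V →L[ℝ] W →L[ℝ] Z) {f : M → V} {g : M → W} {p : M}
    (hf : MDifferentiableAt (𝓡 m) 𝓘(ℝ, V) f p) (hg : MDifferentiableAt (𝓡 m) 𝓘(ℝ, W) g p)
    (u : TangentSpace (𝓡 m) p) :
    mvfderiv (𝓡 m) (fun q => β (f q) (g q)) p u =
      β (mvfderiv (𝓡 m) f p u) (g p) + β (f p) (mvfderiv (𝓡 m) g p u) := by
  have hfg : HasMFDerivAt (𝓡 m) 𝓘(ℝ, V × W) (fun q => (f q, g q)) p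
      ((mvfderiv (𝓡 m) f p).prod (mvfderiv (𝓡 m) g p)) :=
    ⟨hf.hasMFDerivAt.1.prodMk hg.hasMFDerivAt.1, hf.hasMFDerivAt.2.prodMk hg.hasMFDerivAt.2⟩
  have := ((β.isBoundedBilinearMap.hasFDerivAt (f p, g p)).hasMFDerivAt.comp
    (f := fun q => (f q, g q)) p hfg).mfderiv
  refine (congrArg (fun L => L u) this).trans ?_
  exact add_comm _ _

theorem mvfderiv_inner {V : Type*} [NormedAddCommGroup V] [InnerProductSpace ℝ V]
    {f g : M → V} {p : M}
    (hf : MDifferentiableAt (𝓡 m) 𝓘(ℝ, V) f p) (hg : MDifferentiableAt (𝓡 m) 𝓘(ℝ, V) g p)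
    (u : TangentSpace (𝓡 m) p) :
    mvfderiv (𝓡 m) (fun q => ⟪f q, g q⟫) p u =
      ⟪mvfderiv (𝓡 m) f p u, g p⟫ + ⟪f p, mvfderiv (𝓡 m) g p u⟫ :=
  mvfderiv_bilinear (innerSL ℝ) hf hg u

theorem mvfderiv_clm_apply {f : M → V →L[ℝ] W} {g : M → V} {p : M}
    (hf : MDifferentiableAt (𝓡 m) 𝓘(ℝ, V →L[ℝ] W) f p) (hg : MDifferentiableAt (𝓡 m) 𝓘(ℝ, V) g p)
    (u : TangentSpace (𝓡 m) p) :
    mvfderiv (𝓡 m) (fun q => f q (g q)) p u =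
      mvfderiv (𝓡 m) f p u (g p) + f p (mvfderiv (𝓡 m) g p u) :=
  mvfderiv_bilinear (ContinuousLinearMap.id ℝ (V →L[ℝ] W)) hf hg u

theorem mvfderiv_smul_apply {f : M → ℝ} {g : M → V} {p : M}
    (hf : MDifferentiableAt (𝓡 m) 𝓘(ℝ, ℝ) f p) (hg : MDifferentiableAt (𝓡 m) 𝓘(ℝ, V) g p)
    (u : TangentSpace (𝓡 m) p) :
    mvfderiv (𝓡 m) (fun q => f q • g q) p u =
      mvfderiv (𝓡 m) f p u • g p + f p • mvfderiv (𝓡 m) g p u :=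
  mvfderiv_bilinear (ContinuousLinearMap.lsmul ℝ ℝ) hf hg u

theorem mvfderiv_congr {f g : M → V} {p : M} (h : f =ᶠ[nhds p] g) :
    mvfderiv (𝓡 m) f p = mvfderiv (𝓡 m) g p := by
  have h1 := h.mfderiv_eq (I := 𝓡 m) (I' := 𝓘(ℝ, V))
  ext u
  exact congrArg (fun L : TangentSpace (𝓡 m) p →L[ℝ] V => L u) h1

theorem contMDiff_inner {V : Type*} [NormedAddCommGroup V] [InnerProductSpace ℝ V] {f g : M → V}
    (hf : ContMDiff (𝓡 m) 𝓘(ℝ, V) ∞ f) (hg : ContMDiff (𝓡 m) 𝓘(ℝ, V) ∞ g) :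
    ContMDiff (𝓡 m) 𝓘(ℝ, ℝ) ∞ (fun q => ⟪f q, g q⟫) :=
  (contDiff_inner (𝕜 := ℝ)).contMDiff.comp (hf.prodMk_space hg)

variable [IsManifold (𝓡 m) ∞ M]

/-- The tangent trivialization at `p` is the derivative of the chart at `p`, so this is the chain
rule. It holds for every `q` in the chart, not only for `q = p`, which allows the right side to be
differentiated in `q`. -/
theorem mvfderiv_eq_chartFDeriv {G : M → V} {p q : M}
    (hq : q ∈ (chartAt (EuclideanSpace ℝ (Fin m)) p).source)
    (hG : MDifferentiableAt (𝓡 m) 𝓘(ℝ, V) G q) (u : TangentSpace (𝓡 m) q) :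
    mvfderiv (𝓡 m) G q u = chartFDeriv G p q
      ((trivializationAt (EuclideanSpace ℝ (Fin m)) (TangentSpace (𝓡 m)) p).continuousLinearMapAt
        ℝ q u) := by
  have : IsManifold (𝓡 m) 1 M := IsManifold.of_le (n := ∞) (by simp)
  rw [TangentBundle.continuousLinearMapAt_trivializationAt hq]
  have hq' : q ∈ (extChartAt (𝓡 m) p).source := by simpa using hq
  have hsymm : MDifferentiableAt (𝓡 m) (𝓡 m) (extChartAt (𝓡 m) p).symm (extChartAt (𝓡 m) p q) := by
    have := mdifferentiableWithinAt_extChartAt_symm (I := 𝓡 m) ((extChartAt (𝓡 m) p).map_source hq')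
    rwa [modelWithCornersSelf_coe, Set.range_id, mdifferentiableWithinAt_univ] at this
  have hcomp : MDifferentiableAt (𝓡 m) 𝓘(ℝ, V) (G ∘ (extChartAt (𝓡 m) p).symm)
      (extChartAt (𝓡 m) p q) := by
    apply MDifferentiableAt.comp _ _ hsymm
    rwa [(extChartAt (𝓡 m) p).left_inv hq']
  have he : MDifferentiableAt (𝓡 m) 𝓘(ℝ, EuclideanSpace ℝ (Fin m)) (extChartAt (𝓡 m) p) q :=
    mdifferentiableAt_extChartAt hq
  have hev : G =ᶠ[nhds q] fun x => (G ∘ (extChartAt (𝓡 m) p).symm) (extChartAt (𝓡 m) p x) := by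
    filter_upwards [(isOpen_extChartAt_source (I := 𝓡 m) p).mem_nhds hq'] with x hx
    rw [Function.comp_apply, (extChartAt (𝓡 m) p).left_inv hx]
  rw [mvfderiv_congr hev]
  exact mvfderiv_comp_left hcomp.differentiableAt.hasFDerivAt he u

theorem contMDiffAt_chartFDeriv {G : M → V} (hG : ContMDiff (𝓡 m) 𝓘(ℝ, V) ∞ G) (p : M) {q : M}
    (hq : q ∈ (chartAt (EuclideanSpace ℝ (Fin m)) p).source) :
    ContMDiffAt (𝓡 m) 𝓘(ℝ, EuclideanSpace ℝ (Fin m) →L[ℝ] V) ∞ (chartFDeriv (m := m) G p) q := by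
  have hq' : q ∈ (extChartAt (𝓡 m) p).source := by simpa using hq
  have h1 : ContDiffAt ℝ ∞ (G ∘ (extChartAt (𝓡 m) p).symm) (extChartAt (𝓡 m) p q) := by
    have := (hG.contMDiffOn (s := Set.univ)).comp
      (contMDiffOn_extChartAt_symm (I := 𝓡 m) (n := ∞) p) (fun _ _ => Set.mem_univ _)
    exact (contMDiffOn_iff_contDiffOn.1 this).contDiffAt
      ((isOpen_extChartAt_target (I := 𝓡 m) p).mem_nhds ((extChartAt (𝓡 m) p).map_source hq'))
  exact (h1.fderiv_right (m := ∞) (by simp)).contMDiffAt.comp q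
    (contMDiffAt_extChartAt' (I := 𝓡 m) hq)

theorem coordField_self (p : M) (v : TangentSpace (𝓡 m) p) : coordField p v p = v :=
  (trivializationAt (EuclideanSpace ℝ (Fin m)) (TangentSpace (𝓡 m)) p).symmL_continuousLinearMapAt
    (FiberBundle.mem_baseSet_trivializationAt' p) v

theorem mvfderiv_coordField_eventuallyEq {G : M → V} (hG : ContMDiff (𝓡 m) 𝓘(ℝ, V) ∞ G) (p : M)
    (v : TangentSpace (𝓡 m) p) :
    (fun q => mvfderiv (𝓡 m) G q (coordField p v q)) =ᶠ[nhds p] fun q => chartFDeriv G p q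
      ((trivializationAt (EuclideanSpace ℝ (Fin m)) (TangentSpace (𝓡 m)) p).continuousLinearMapAt
        ℝ p v) := by
  filter_upwards [(chartAt (EuclideanSpace ℝ (Fin m)) p).open_source.mem_nhds
    (mem_chart_source _ p)] with q hq
  rw [mvfderiv_eq_chartFDeriv hq ((hG q).mdifferentiableAt (by simp)), coordField,
    Trivialization.continuousLinearMapAt_symmL _ (by simpa using hq)]

theorem contMDiffAt_mvfderiv_coordField {G : M → V} (hG : ContMDiff (𝓡 m) 𝓘(ℝ, V) ∞ G) (p : M)
    (v : TangentSpace (𝓡 m) p) :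
    ContMDiffAt (𝓡 m) 𝓘(ℝ, V) ∞ (fun q => mvfderiv (𝓡 m) G q (coordField p v q)) p :=
  ((contMDiffAt_chartFDeriv hG p (mem_chart_source _ p)).clm_apply
    contMDiffAt_const).congr_of_eventuallyEq (mvfderiv_coordField_eventuallyEq hG p v)

/-- Second derivatives in the directions of coordinate fields commute. -/
theorem mvfderiv_mvfderiv_coordField_comm {G : M → V} (hG : ContMDiff (𝓡 m) 𝓘(ℝ, V) ∞ G) (p : M)
    (u v : TangentSpace (𝓡 m) p) :
    mvfderiv (𝓡 m) (fun q => mvfderiv (𝓡 m) G q (coordField p v q)) p u =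
      mvfderiv (𝓡 m) (fun q => mvfderiv (𝓡 m) G q (coordField p u q)) p v := by
  have : IsManifold (𝓡 m) 1 M := IsManifold.of_le (n := ∞) (by simp)
  have h1 : ContDiffAt ℝ ∞ (G ∘ (extChartAt (𝓡 m) p).symm) (extChartAt (𝓡 m) p p) := by
    have := (hG.contMDiffOn (s := Set.univ)).comp
      (contMDiffOn_extChartAt_symm (I := 𝓡 m) (n := ∞) p) (fun _ _ => Set.mem_univ _)
    exact (contMDiffOn_iff_contDiffOn.1 this).contDiffAt (extChartAt_target_mem_nhds p)
  have h2 : DifferentiableAt ℝ (fderiv ℝ (G ∘ (extChartAt (𝓡 m) p).symm))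
      (extChartAt (𝓡 m) p p) := (h1.fderiv_right (m := ∞) (by simp)).differentiableAt (by simp)
  have he : MDifferentiableAt (𝓡 m) 𝓘(ℝ, EuclideanSpace ℝ (Fin m)) (extChartAt (𝓡 m) p) p :=
    mdifferentiableAt_extChartAt (mem_chart_source _ p)
  -- A coordinate field has constant components, so both iterated derivatives are values of one
  -- second Fréchet derivative, which is symmetric.
  have key : ∀ u v : TangentSpace (𝓡 m) p,
      mvfderiv (𝓡 m) (fun q => mvfderiv (𝓡 m) G q (coordField p v q)) p u =
      fderiv ℝ (fderiv ℝ (G ∘ (extChartAt (𝓡 m) p).symm)) (extChartAt (𝓡 m) p p)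
        ((trivializationAt (EuclideanSpace ℝ (Fin m)) (TangentSpace (𝓡 m))
          p).continuousLinearMapAt ℝ p u)
        ((trivializationAt (EuclideanSpace ℝ (Fin m)) (TangentSpace (𝓡 m))
          p).continuousLinearMapAt ℝ p v) := by
    intro u v
    rw [mvfderiv_congr (mvfderiv_coordField_eventuallyEq hG p v),
      TangentBundle.continuousLinearMapAt_trivializationAt (mem_chart_source _ p)]
    exact mvfderiv_comp_left (((ContinuousLinearMap.apply ℝ V
      (mfderiv (𝓡 m) 𝓘(ℝ, EuclideanSpace ℝ (Fin m)) (extChartAt (𝓡 m) p) p v)).hasFDerivAt).comp _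
      h2.hasFDerivAt) he u
  rw [key, key]
  exact (h1.isSymmSndFDerivAt (by simpa using ENat.LEInfty.out)) _ _

end ChartCalculus

theorem contMDiff_coe_sph {n : ℕ} :
    ContMDiff (𝓡 n) 𝓘(ℝ, Ambient n) ∞ (fun x : Sph n => (x : Ambient n)) :=
  have := Fact.mk (@finrank_euclideanSpace_fin ℝ _ (n + 1))
  contMDiff_coe_sphere

/-! ### Tangential derivatives and their smoothness -/

section Tangential

variable {m : ℕ} {M : Type*} [TopologicalSpace M] [ChartedSpace (EuclideanSpace ℝ (Fin m)) M]
  [IsManifold (𝓡 m) ∞ M] [RiemannianBundle (fun p : M => TangentSpace (𝓡 m) p)]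
  {n : ℕ} {φ : M → Sph n}
  {V : Type*} [NormedAddCommGroup V] [NormedSpace ℝ V]

omit [IsManifold (𝓡 m) ∞ M] in
theorem sum_inner_onb_smul (p : M) (u : TangentSpace (𝓡 m) p) :
    ∑ i, ⟪onb p i, u⟫ • onb p i = u :=
  (onb p).sum_repr' u

omit [IsManifold (𝓡 m) ∞ M] in
-- Linearity has to be assumed: `sharp` accepts any function and sees only its values on the basis.
theorem inner_sharp (p : M) {α : TangentSpace (𝓡 m) p → ℝ} (hα : IsLinearMap ℝ α)
    (w : TangentSpace (𝓡 m) p) : ⟪sharp p α, w⟫ = α w := by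
  have h : α w = hα.mk' α (∑ i, ⟪onb p i, w⟫ • onb p i) := by
    rw [sum_inner_onb_smul]; rfl
  rw [h, map_sum, sharp, sum_inner]
  refine Finset.sum_congr rfl fun i _ => ?_
  rw [real_inner_smul_left, map_smul, smul_eq_mul, mul_comm]
  rfl

omit [IsManifold (𝓡 m) ∞ M] in
theorem IsIsometricImmersion.contMDiff_coe (hφ : IsIsometricImmersion m φ) :
    ContMDiff (𝓡 m) 𝓘(ℝ, Ambient n) ∞ (fun q => (φ q : Ambient n)) :=
  contMDiff_coe_sph.comp hφ.smooth

variable (m) in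
/-- For `G : M → V`, the derivative of `G` at `q` in the direction of the tangential part of an
ambient vector. -/
def tangentialDeriv (φ : M → Sph n) (G : M → V) (q : M) : Ambient n →L[ℝ] V :=
  ∑ i, (innerSL ℝ (dmap φ q (onb (m := m) q i))).smulRight (mvfderiv (𝓡 m) G q (onb q i))

omit [IsManifold (𝓡 m) ∞ M] in
theorem tangentialDeriv_apply (G : M → V) (q : M) (w : Ambient n) :
    tangentialDeriv m φ G q w =
      ∑ i, ⟪dmap φ q (onb (m := m) q i), w⟫ • mvfderiv (𝓡 m) G q (onb q i) := by
  simp [tangentialDeriv]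

omit [IsManifold (𝓡 m) ∞ M] in
theorem tangentialDeriv_eq_mvfderiv_sharp (G : M → V) (q : M) (w : Ambient n) :
    tangentialDeriv m φ G q w =
      mvfderiv (𝓡 m) G q (sharp q fun u => ⟪dmap φ q u, w⟫) := by
  simp [tangentialDeriv_apply, sharp, map_sum]

omit [IsManifold (𝓡 m) ∞ M] in
theorem tangentialDeriv_dmap (hφ : IsIsometricImmersion m φ) (G : M → V) (q : M)
    (u : TangentSpace (𝓡 m) q) :
    tangentialDeriv m φ G q (dmap φ q u) = mvfderiv (𝓡 m) G q u := by
  simp_rw [tangentialDeriv_apply, hφ.isometric, ← map_smul, ← map_sum, sum_inner_onb_smul]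

omit [IsManifold (𝓡 m) ∞ M] in
theorem tangentialDeriv_eq_zero (G : M → V) (q : M) {w : Ambient n}
    (hw : ∀ u : TangentSpace (𝓡 m) q, ⟪dmap φ q u, w⟫ = 0) :
    tangentialDeriv m φ G q w = 0 := by
  simp [tangentialDeriv_apply, hw]

/-- Taking adjoints, as a continuous linear map over `ℝ`. -/
def adjointL (E F : Type*) [NormedAddCommGroup E] [InnerProductSpace ℝ E] [CompleteSpace E]
    [NormedAddCommGroup F] [InnerProductSpace ℝ F] [CompleteSpace F] :
    (E →L[ℝ] F) →L[ℝ] (F →L[ℝ] E) :=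
  LinearMap.mkContinuous
    { toFun := fun L => ContinuousLinearMap.adjoint L
      map_add' := fun L L' => map_add _ L L'
      map_smul' := fun c L => by simp } 1 (fun L => by simp)

/-- The left inverse `(L* L)⁻¹ L*` of an injective linear map `L`. -/
def leftInverse {E F : Type*} [NormedAddCommGroup E] [InnerProductSpace ℝ E] [CompleteSpace E]
    [NormedAddCommGroup F] [InnerProductSpace ℝ F] [CompleteSpace F] (L : E →L[ℝ] F) : F →L[ℝ] E :=
  (adjointL E F L ∘L L).inverse ∘L adjointL E F L

/-! ### A left inverse depending smoothly on the operator -/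

section LeftInverse

variable {E F : Type*} [NormedAddCommGroup E] [InnerProductSpace ℝ E] [FiniteDimensional ℝ E]
    [NormedAddCommGroup F] [InnerProductSpace ℝ F] [CompleteSpace F]

/-- ⟨L* L v, v⟩ = |L v|² gives injectivity, and an injective endomorphism of a finite-dimensional
space is invertible. -/
theorem isInvertible_adjointL_comp_self {L : E →L[ℝ] F} (hL : Function.Injective L) :
    (adjointL E F L ∘L L).IsInvertible := by
  have hinj : Function.Injective (adjointL E F L ∘L L) := by
    rw [injective_iff_map_eq_zero]
    intro v hv
    apply hL
    rw [map_zero, ← inner_self_eq_zero (𝕜 := ℝ), ← ContinuousLinearMap.adjoint_inner_left]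
    change ⟪(adjointL E F L ∘L L) v, v⟫ = 0
    rw [hv, inner_zero_left]
  have hinj' : Function.Injective (adjointL E F L ∘L L : E →L[ℝ] E).toLinearMap := hinj
  exact ⟨(LinearEquiv.ofInjectiveEndo _ hinj').toContinuousLinearEquiv, by ext; rfl⟩

/-- `leftInverse L w` is the solution of the normal equation. -/
theorem leftInverse_eq {L : E →L[ℝ] F} (hL : Function.Injective L) {w : F} {v : E}
    (h : ∀ v', ⟪L v, L v'⟫ = ⟪w, L v'⟫) : leftInverse L w = v := by
  have h1 : adjointL E F L w = (adjointL E F L ∘L L) v := by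
    refine ext_inner_right ℝ fun v' => ?_
    change ⟪ContinuousLinearMap.adjoint L w, v'⟫ = ⟪ContinuousLinearMap.adjoint L (L v), v'⟫
    rw [ContinuousLinearMap.adjoint_inner_left, ContinuousLinearMap.adjoint_inner_left, h]
  rw [leftInverse, ContinuousLinearMap.comp_apply, h1]
  exact (isInvertible_adjointL_comp_self hL).inverse_apply_eq.2 rfl

theorem contDiffAt_leftInverse {L : E →L[ℝ] F} (hL : Function.Injective L) :
    ContDiffAt ℝ ∞ (leftInverse : (E →L[ℝ] F) → F →L[ℝ] E) L := by
  have h1 : ContDiffAt ℝ ∞ (fun L : E →L[ℝ] F => adjointL E F L ∘L L) L :=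
    (adjointL E F).contDiff.contDiffAt.clm_comp contDiffAt_id
  have h2 := ContDiffAt.comp (f := fun L : E →L[ℝ] F => adjointL E F L ∘L L) L
    (isInvertible_adjointL_comp_self hL).contDiffAt_map_inverse h1
  exact h2.clm_comp (adjointL E F).contDiff.contDiffAt

end LeftInverse

theorem chartFDeriv_coe_apply (hφ : IsIsometricImmersion m φ) {p q : M}
    (hq : q ∈ (chartAt (EuclideanSpace ℝ (Fin m)) p).source) (v : EuclideanSpace ℝ (Fin m)) :
    chartFDeriv (fun x => (φ x : Ambient n)) p q v = dmap φ q
      ((trivializationAt (EuclideanSpace ℝ (Fin m)) (TangentSpace (𝓡 m)) p).symmL ℝ q v) := by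
  rw [dmap, mvfderiv_eq_chartFDeriv hq ((hφ.contMDiff_coe q).mdifferentiableAt (by simp)),
    Trivialization.continuousLinearMapAt_symmL _ (by simpa using hq)]

theorem injective_chartFDeriv (hφ : IsIsometricImmersion m φ) {p q : M}
    (hq : q ∈ (chartAt (EuclideanSpace ℝ (Fin m)) p).source) :
    Function.Injective (chartFDeriv (m := m) (fun x => (φ x : Ambient n)) p q) := by
  rw [injective_iff_map_eq_zero]
  intro v hv
  rw [chartFDeriv_coe_apply hφ hq] at hv
  have h := hφ.isometric q
    ((trivializationAt (EuclideanSpace ℝ (Fin m)) (TangentSpace (𝓡 m)) p).symmL ℝ q v)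
    ((trivializationAt (EuclideanSpace ℝ (Fin m)) (TangentSpace (𝓡 m)) p).symmL ℝ q v)
  rw [hv, inner_zero_left, eq_comm, inner_self_eq_zero] at h
  rw [← Trivialization.continuousLinearMapAt_symmL (R := ℝ)
    (trivializationAt (EuclideanSpace ℝ (Fin m)) (TangentSpace (𝓡 m)) p)
    (b := q) (by simpa using hq) v, h, map_zero]

theorem leftInverse_chartFDeriv_apply (hφ : IsIsometricImmersion m φ) {p q : M}
    (hq : q ∈ (chartAt (EuclideanSpace ℝ (Fin m)) p).source) {w : Ambient n}
    {u : TangentSpace (𝓡 m) q} (h : ∀ u', ⟪u, u'⟫ = ⟪w, dmap φ q u'⟫) :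
    leftInverse (chartFDeriv (fun x => (φ x : Ambient n)) p q) w =
      (trivializationAt (EuclideanSpace ℝ (Fin m)) (TangentSpace (𝓡 m)) p).continuousLinearMapAt
        ℝ q u := by
  refine leftInverse_eq (injective_chartFDeriv hφ hq) fun v' => ?_
  rw [chartFDeriv_coe_apply hφ hq, chartFDeriv_coe_apply hφ hq,
    Trivialization.symmL_continuousLinearMapAt _ (by simpa using hq), hφ.isometric, h]

theorem contMDiffAt_leftInverse_chartFDeriv (hφ : IsIsometricImmersion m φ) (p : M) :
    ContMDiffAt (𝓡 m) 𝓘(ℝ, Ambient n →L[ℝ] EuclideanSpace ℝ (Fin m)) ∞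
      (fun q => leftInverse (chartFDeriv (m := m) (fun x => (φ x : Ambient n)) p q)) p :=
  (contDiffAt_leftInverse (injective_chartFDeriv hφ (mem_chart_source _ p))).contMDiffAt.comp p
    (contMDiffAt_chartFDeriv hφ.contMDiff_coe p (mem_chart_source _ p))

/-- The frame `onb q` is chosen point by point with no continuity, so the defining sum does not show
smoothness. Near `p` the operator equals the chart derivative of `G` composed with the left inverse
of the chart derivative of `φ`, and both factors are smooth in `q`. -/
theorem contMDiff_tangentialDeriv (hφ : IsIsometricImmersion m φ) {G : M → V}
    (hG : ContMDiff (𝓡 m) 𝓘(ℝ, V) ∞ G) :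
    ContMDiff (𝓡 m) 𝓘(ℝ, Ambient n →L[ℝ] V) ∞ (tangentialDeriv m φ G) := by
  intro p
  refine ((contMDiffAt_chartFDeriv hG p (mem_chart_source _ p)).clm_comp
    (contMDiffAt_leftInverse_chartFDeriv hφ p)).congr_of_eventuallyEq ?_
  filter_upwards [(chartAt (EuclideanSpace ℝ (Fin m)) p).open_source.mem_nhds
    (mem_chart_source _ p)] with q hq
  ext1 w
  rw [tangentialDeriv_eq_mvfderiv_sharp,
    mvfderiv_eq_chartFDeriv hq ((hG q).mdifferentiableAt (by simp)), ContinuousLinearMap.comp_apply,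
    leftInverse_chartFDeriv_apply hφ hq (u := sharp q fun u => ⟪dmap φ q u, w⟫)]
  intro u'
  rw [inner_sharp, real_inner_comm]
  exact ⟨fun x y => by rw [map_add, inner_add_left],
    fun c x => by rw [map_smul, real_inner_smul_left, smul_eq_mul]⟩

omit [RiemannianBundle (fun p : M => TangentSpace (𝓡 m) p)] in
theorem trivializationAt_snd_eventuallyEq (p : M) (Y : ∀ q : M, TangentSpace (𝓡 m) q) :
    (fun q => (trivializationAt (EuclideanSpace ℝ (Fin m)) (TangentSpace (𝓡 m)) p ⟨q, Y q⟩).2)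
      =ᶠ[nhds p] fun q => (trivializationAt (EuclideanSpace ℝ (Fin m))
        (TangentSpace (𝓡 m)) p).continuousLinearMapAt ℝ q (Y q) := by
  filter_upwards [(chartAt (EuclideanSpace ℝ (Fin m)) p).open_source.mem_nhds
    (mem_chart_source _ p)] with q hq
  rw [Trivialization.continuousLinearMapAt_apply, Trivialization.linearMapAt_apply,
    if_pos (by simpa using hq)]

/-- A vector field is smooth if its image under the differential of an isometric immersion is. -/
theorem contMDiff_section_of_dmap (hφ : IsIsometricImmersion m φ)
    {Y : ∀ q : M, TangentSpace (𝓡 m) q}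
    (hY : ContMDiff (𝓡 m) 𝓘(ℝ, Ambient n) ∞ (fun q => dmap φ q (Y q))) :
    ContMDiff (𝓡 m) (𝓡 m).tangent ∞ (fun p => (⟨p, Y p⟩ : TangentBundle (𝓡 m) M)) := by
  intro p
  refine (contMDiffAt_section (IB := 𝓡 m) (F := EuclideanSpace ℝ (Fin m))
    (E := TangentSpace (𝓡 m)) p).2 ?_
  refine ((contMDiffAt_leftInverse_chartFDeriv hφ p).clm_apply (hY p)).congr_of_eventuallyEq
    ((trivializationAt_snd_eventuallyEq p Y).trans ?_)
  filter_upwards [(chartAt (EuclideanSpace ℝ (Fin m)) p).open_source.mem_nhds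
    (mem_chart_source _ p)] with q hq
  exact (leftInverse_chartFDeriv_apply hφ hq fun u' => (hφ.isometric q _ _).symm).symm

end Tangential

/-! ### The Gauss formula and the divergence in ambient terms -/

section Gauss

variable {m : ℕ} {M : Type*} [TopologicalSpace M] [ChartedSpace (EuclideanSpace ℝ (Fin m)) M]
  [IsManifold (𝓡 m) ∞ M] [RiemannianBundle (fun p : M => TangentSpace (𝓡 m) p)]
  {n : ℕ} {φ : M → Sph n}

/-- The ambient second derivative of `φ` in the direction of coordinate fields at `p`. -/
def coordHess (φ : M → Sph n) (p : M) (u v : TangentSpace (𝓡 m) p) : Ambient n :=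
  mvfderiv (𝓡 m) (fun q => dmap φ q (coordField p v q)) p u

theorem coordHess_comm (hφ : IsIsometricImmersion m φ) (p : M) (u v : TangentSpace (𝓡 m) p) :
    coordHess φ p u v = coordHess φ p v u :=
  mvfderiv_mvfderiv_coordField_comm hφ.contMDiff_coe p u v

theorem mdifferentiableAt_dmap_coordField (hφ : IsIsometricImmersion m φ) (p : M)
    (v : TangentSpace (𝓡 m) p) :
    MDifferentiableAt (𝓡 m) 𝓘(ℝ, Ambient n) (fun q => dmap φ q (coordField p v q)) p :=
  (contMDiffAt_mvfderiv_coordField hφ.contMDiff_coe p v).mdifferentiableAt (by simp)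

theorem mvfderiv_inner_coordField (hφ : IsIsometricImmersion m φ) (p : M)
    (u v w : TangentSpace (𝓡 m) p) :
    mvfderiv (𝓡 m) (fun q => ⟪coordField p v q, coordField p w q⟫) p u =
      ⟪coordHess φ p u v, dmap φ p w⟫ + ⟪dmap φ p v, coordHess φ p u w⟫ := by
  simp_rw [← hφ.isometric]
  rw [mvfderiv_inner (mdifferentiableAt_dmap_coordField hφ p v)
    (mdifferentiableAt_dmap_coordField hφ p w), coordField_self, coordField_self]
  rfl

/-- Since the metric is induced by `φ`, each derivative in the Koszul expression splits into two
pairings with `coordHess`. Symmetry of `coordHess` cancels four of the six, and the other two are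
equal. -/
theorem inner_christoffel (hφ : IsIsometricImmersion m φ) (p : M)
    (u v w : TangentSpace (𝓡 m) p) :
    ⟪christoffel p u v, w⟫ = ⟪coordHess φ p u v, dmap φ p w⟫ := by
  have h : ∀ w, (mvfderiv (𝓡 m) (fun q => ⟪coordField p v q, coordField p w q⟫) p u +
      mvfderiv (𝓡 m) (fun q => ⟪coordField p u q, coordField p w q⟫) p v -
      mvfderiv (𝓡 m) (fun q => ⟪coordField p u q, coordField p v q⟫) p w) / 2 =
      ⟪coordHess φ p u v, dmap φ p w⟫ := by
    intro w
    simp_rw [mvfderiv_inner_coordField hφ]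
    rw [coordHess_comm hφ p v u, coordHess_comm hφ p w u, coordHess_comm hφ p w v,
      real_inner_comm (dmap φ p v) (coordHess φ p u w)]
    ring
  rw [christoffel, inner_sharp]
  · exact h w
  · refine ⟨fun x y => ?_, fun c x => ?_⟩
    · rw [h, h, h, map_add, inner_add_right]
    · rw [h, h, map_smul, inner_smul_right, smul_eq_mul]

/-- The Gauss formula: the tangential part of the ambient derivative of a tangent vector field is
its Levi-Civita derivative. -/
theorem inner_mvfderiv_dmap (hφ : IsIsometricImmersion m φ) {Y : ∀ q : M, TangentSpace (𝓡 m) q}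
    {p : M} (hY : MDifferentiableAt (𝓡 m) 𝓘(ℝ, EuclideanSpace ℝ (Fin m))
      (fun q => (trivializationAt (EuclideanSpace ℝ (Fin m))
        (TangentSpace (𝓡 m)) p).continuousLinearMapAt ℝ q (Y q)) p) (u w : TangentSpace (𝓡 m) p) :
    ⟪mvfderiv (𝓡 m) (fun q => dmap φ q (Y q)) p u, dmap φ p w⟫ = ⟪leviCivita Y p u, w⟫ := by
  have hL : MDifferentiableAt (𝓡 m) 𝓘(ℝ, EuclideanSpace ℝ (Fin m) →L[ℝ] Ambient n)
      (chartFDeriv (fun x => (φ x : Ambient n)) p) p :=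
    (contMDiffAt_chartFDeriv hφ.contMDiff_coe p (mem_chart_source _ p)).mdifferentiableAt (by simp)
  have h1 : (fun q => dmap φ q (Y q)) =ᶠ[nhds p] fun q =>
      chartFDeriv (fun x => (φ x : Ambient n)) p q ((trivializationAt (EuclideanSpace ℝ (Fin m))
        (TangentSpace (𝓡 m)) p).continuousLinearMapAt ℝ q (Y q)) := by
    filter_upwards [(chartAt (EuclideanSpace ℝ (Fin m)) p).open_source.mem_nhds
      (mem_chart_source _ p)] with q hq
    exact mvfderiv_eq_chartFDeriv hq ((hφ.contMDiff_coe q).mdifferentiableAt (by simp)) _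
  -- The coordinate field through `Y p` has constant components, so only the chart derivative of `φ`
  -- is differentiated; this is the Christoffel part of the product rule below.
  have h2 : coordHess φ p u (Y p) =
      mvfderiv (𝓡 m) (chartFDeriv (fun x => (φ x : Ambient n)) p) p u
        ((trivializationAt (EuclideanSpace ℝ (Fin m))
          (TangentSpace (𝓡 m)) p).continuousLinearMapAt ℝ p (Y p)) := by
    refine (congrArg (fun L => L u)
      (mvfderiv_congr (mvfderiv_coordField_eventuallyEq hφ.contMDiff_coe p (Y p)))).trans ?_
    rw [mvfderiv_clm_apply hL mdifferentiableAt_const, mvfderiv_const]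
    simp
  rw [mvfderiv_congr h1, mvfderiv_clm_apply hL hY, ← h2,
    chartFDeriv_coe_apply hφ (mem_chart_source _ p), inner_add_left, hφ.isometric,
    ← inner_christoffel hφ, ← inner_add_left, add_comm]
  rfl

theorem inner_leviCivita_coordField (hφ : IsIsometricImmersion m φ) (p : M)
    (u v w : TangentSpace (𝓡 m) p) :
    ⟪coordHess φ p u v, dmap φ p w⟫ = ⟪leviCivita (coordField p v) p u, w⟫ := by
  refine inner_mvfderiv_dmap hφ ?_ u w
  refine (mdifferentiableAt_const (c := (trivializationAt (EuclideanSpace ℝ (Fin m))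
    (TangentSpace (𝓡 m)) p).continuousLinearMapAt ℝ p v)).congr_of_eventuallyEq ?_
  filter_upwards [(chartAt (EuclideanSpace ℝ (Fin m)) p).open_source.mem_nhds
    (mem_chart_source _ p)] with q hq
  exact Trivialization.continuousLinearMapAt_symmL _ (by simpa using hq) _

/-- This removes Christoffel symbols from the final computation: the divergence becomes a trace of
plain ambient derivatives. -/
theorem divergence_eq_sum_inner (hφ : IsIsometricImmersion m φ)
    {Y : ∀ q : M, TangentSpace (𝓡 m) q}
    (hY : ContMDiff (𝓡 m) 𝓘(ℝ, Ambient n) ∞ (fun q => dmap φ q (Y q))) (p : M) :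
    divergence Y p = ∑ i, ⟪mvfderiv (𝓡 m) (fun q => dmap φ q (Y q)) p (onb p i),
      dmap φ p (onb p i)⟫ := by
  have h := (contMDiffAt_section (IB := 𝓡 m) (F := EuclideanSpace ℝ (Fin m))
    (E := TangentSpace (𝓡 m)) p).1 (contMDiff_section_of_dmap hφ hY p)
  have h' := (h.mdifferentiableAt (by simp)).congr_of_eventuallyEq
    (trivializationAt_snd_eventuallyEq p Y).symm
  simp_rw [inner_mvfderiv_dmap hφ h']
  rfl

omit [IsManifold (𝓡 m) ∞ M] in
theorem inner_coe_dmap (hφ : IsIsometricImmersion m φ) (p : M) (u : TangentSpace (𝓡 m) p) :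
    ⟪(φ p : Ambient n), dmap φ p u⟫ = 0 := by
  have hd := (hφ.contMDiff_coe p).mdifferentiableAt (by simp)
  have h := mvfderiv_inner hd hd u
  have h1 : (fun q => ⟪(φ q : Ambient n), (φ q : Ambient n)⟫) = fun _ => (1 : ℝ) := by
    ext q; simp
  rw [h1, mvfderiv_const, real_inner_comm, ← two_mul] at h
  simpa [dmap] using h.symm

/-! ### Curvature of the round sphere -/

theorem norm_coe_sph (x : Sph n) : ‖(x : Ambient n)‖ = 1 := by simp

theorem inner_tanProj_of_orthogonal {x w v : Ambient n} (h : ⟪x, v⟫ = 0) :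
    ⟪tanProj x w, v⟫ = ⟪w, v⟫ := by
  rw [tanProj, inner_sub_left, real_inner_smul_left, h, mul_zero, sub_zero]

theorem inner_tanProj_self (x : Sph n) (w : Ambient n) :
    ⟪(x : Ambient n), tanProj (x : Ambient n) w⟫ = 0 := by
  rw [tanProj, inner_sub_right, real_inner_smul_right, real_inner_self_eq_norm_sq, norm_coe_sph]
  ring

/-- The curvature tensor of the unit sphere. -/
theorem sphereCurvature_eq (x : Sph n) {a b c : Ambient n} (ha : ⟪(x : Ambient n), a⟫ = 0)
    (hb : ⟪(x : Ambient n), b⟫ = 0) (hc : ⟪(x : Ambient n), c⟫ = 0) :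
    sphereCurvature (x : Ambient n) a b c = ⟪b, c⟫ • a - ⟪a, c⟫ • b := by
  have hx : ⟪(x : Ambient n), (x : Ambient n)⟫ = 1 := by simp
  have hd : ∀ c y u : Ambient n, fderiv ℝ (fun y => tanProj y c) y u =
      -(⟪u, c⟫ • y + ⟪y, c⟫ • u) := by
    intro c y u
    have h1 : HasFDerivAt (fun y : Ambient n => tanProj y c) _ y :=
      (hasFDerivAt_const c y).sub (((hasFDerivAt_id y).inner ℝ (hasFDerivAt_const c y)).smul
        (hasFDerivAt_id y))
    rw [h1.fderiv]
    simp [add_comm]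
  have hE : ∀ {a b : Ambient n}, ⟪(x : Ambient n), a⟫ = 0 → ⟪(x : Ambient n), b⟫ = 0 →
      ambConn (fun y => ambConn (fun y => tanProj y c) y (tanProj y b)) (x : Ambient n)
        (tanProj (x : Ambient n) a) = -(⟪a, c⟫ • b) := by
    intro a b ha hb
    -- The formula must hold off the sphere because it is differentiated again. The radial term with
    -- factor 1 − |y|² contributes nothing at x: the factor vanishes there, and so does its
    -- derivative in the tangent direction `a`.
    have h0 : (fun y => ambConn (fun y => tanProj y c) y (tanProj y b)) = fun y : Ambient n =>
        (-(⟪tanProj y b, c⟫ * (1 - ⟪y, y⟫))) • y - ⟪y, c⟫ • tanProj y (tanProj y b) := by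
      ext1 y
      rw [ambConn, hd]
      simp only [tanProj, inner_neg_right, inner_add_right, real_inner_smul_right, inner_sub_right]
      module
    have htx : ∀ {w : Ambient n}, ⟪(x : Ambient n), w⟫ = 0 → tanProj (x : Ambient n) w = w := by
      intro w hw
      rw [tanProj, hw, zero_smul, sub_zero]
    have hP : ∀ {f : Ambient n → Ambient n}, Differentiable ℝ f →
        Differentiable ℝ fun y => tanProj y (f y) := fun hf =>
      hf.sub ((differentiable_id.inner ℝ hf).smul differentiable_id)
    have hT := hP (hP (differentiable_const b))
    have hs : Differentiable ℝ fun y : Ambient n => -(⟪tanProj y b, c⟫ * (1 - ⟪y, y⟫)) :=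
      (((hP (differentiable_const b)).inner ℝ (differentiable_const c)).mul
        ((differentiable_const 1).sub (differentiable_id.inner ℝ differentiable_id))).neg
    have hr : HasFDerivAt (fun y : Ambient n => ⟪y, c⟫) _ (x : Ambient n) :=
      (hasFDerivAt_id (x : Ambient n)).inner ℝ (hasFDerivAt_const c (x : Ambient n))
    have h1 := ((hs x).hasFDerivAt.smul (hasFDerivAt_id (x : Ambient n))).sub
      (hr.smul (hT x).hasFDerivAt)
    rw [h0, htx ha, ambConn]
    have h2 : fderiv ℝ (fun y : Ambient n =>
        (-(⟪tanProj y b, c⟫ * (1 - ⟪y, y⟫))) • y - ⟪y, c⟫ • tanProj y (tanProj y b)) x a = _ :=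
      congrArg (fun L => L a) h1.fderiv
    rw [h2]
    simp [hc, tanProj, inner_sub_right, real_inner_smul_right, hb]
    module
  -- As `c` is tangent at x, its projected extension has radial derivative there. Hence the bracket
  -- term of the curvature drops out, whatever the bracket is.
  have hN : ∀ z : Ambient n, ambConn (fun y => tanProj y c) (x : Ambient n) z = 0 := by
    intro z
    rw [ambConn, hd, hc]
    simp [tanProj, real_inner_smul_right]
  rw [sphereCurvature, hE ha hb, hE hb ha, hN]
  module

end Gauss

/-! ### Shape operator, mean curvature and tension field -/

section Hypersurface

variable {m : ℕ} {M : Type*} [TopologicalSpace M] [ChartedSpace (EuclideanSpace ℝ (Fin m)) M]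
  [IsManifold (𝓡 m) ∞ M] [RiemannianBundle (fun p : M => TangentSpace (𝓡 m) p)]
  {φ : M → Sph (m + 1)} {ν : M → Ambient (m + 1)}

omit [IsManifold (𝓡 m) ∞ M] [RiemannianBundle (fun p : M => TangentSpace (𝓡 m) p)] in
theorem finrank_tangentSpace (p : M) : Module.finrank ℝ (TangentSpace (𝓡 m) p) = m :=
  finrank_euclideanSpace_fin (𝕜 := ℝ) (n := m)

omit [IsManifold (𝓡 m) ∞ M] in
/-- The differential, the normal vector and the position vector span the ambient space. -/
theorem eq_zero_of_inner_eq_zero (hφ : IsIsometricImmersion m φ) (hν : IsUnitNormal φ ν) {p : M}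
    {w : Ambient (m + 1)} (ht : ∀ u : TangentSpace (𝓡 m) p, ⟪dmap φ p u, w⟫ = 0)
    (hn : ⟪ν p, w⟫ = 0) (hx : ⟪(φ p : Ambient (m + 1)), w⟫ = 0) : w = 0 := by
  let b : Fin (Module.finrank ℝ (TangentSpace (𝓡 m) p)) ⊕ Fin 2 → Ambient (m + 1) :=
    Sum.elim (fun i => dmap φ p (onb p i)) ![ν p, φ p]
  have hb : Orthonormal ℝ b := by
    rw [orthonormal_iff_ite]
    have h1 := orthonormal_iff_ite.1 (onb (m := m) p).orthonormal
    have h2 : ⟪ν p, ν p⟫ = 1 := by rw [real_inner_self_eq_norm_sq, hν.unit]; norm_num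
    have h3 : ⟪ν p, (φ p : Ambient (m + 1))⟫ = 0 := by
      rw [real_inner_comm, hν.tangent_sphere]
    rintro (i | i) (j | j)
    · simpa [b, hφ.isometric] using h1 i j
    · fin_cases j
      · simp [b, hν.normal]
      · simp [b, real_inner_comm, inner_coe_dmap hφ]
    · fin_cases i
      · simpa [b] using (real_inner_comm _ _).trans (hν.normal p (onb p j))
      · simp [b, inner_coe_dmap hφ]
    · fin_cases i <;> fin_cases j <;> simp [b, h3, hν.tangent_sphere, hν.unit]
  have hc : Fintype.card (Fin (Module.finrank ℝ (TangentSpace (𝓡 m) p)) ⊕ Fin 2) =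
      Module.finrank ℝ (Ambient (m + 1)) := by
    simp [finrank_tangentSpace]
  refine InnerProductSpace.ext_inner_left_basis (𝕜 := ℝ)
    (basisOfOrthonormalOfCardEqFinrank hb hc) fun i => ?_
  rw [coe_basisOfOrthonormalOfCardEqFinrank, inner_zero_right]
  rcases i with i | i
  · exact ht _
  · fin_cases i
    · exact hn
    · exact hx

/-- Minus the ambient derivative of the normal field, as an endomorphism of the ambient space which
vanishes on the normal and the position vector. -/
def ambientShape (φ : M → Sph (m + 1)) (ν : M → Ambient (m + 1)) (q : M) :
    Ambient (m + 1) →L[ℝ] Ambient (m + 1) :=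
  -tangentialDeriv m φ ν q

/-- The trace of the shape operator. -/
def traceShape (φ : M → Sph (m + 1)) (ν : M → Ambient (m + 1)) (q : M) : ℝ :=
  ∑ b, ⟪ambientShape φ ν q (EuclideanSpace.basisFun (Fin (m + 1 + 1)) ℝ b),
    EuclideanSpace.basisFun (Fin (m + 1 + 1)) ℝ b⟫

theorem contMDiff_ambientShape (hφ : IsIsometricImmersion m φ) (hν : IsUnitNormal φ ν) :
    ContMDiff (𝓡 m) 𝓘(ℝ, Ambient (m + 1) →L[ℝ] Ambient (m + 1)) ∞ (ambientShape φ ν) :=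
  (contMDiff_tangentialDeriv hφ hν.smooth).neg

/-- The trace runs over a fixed basis of the ambient space rather than a tangent frame, so
smoothness passes directly from `ambientShape`. -/
theorem contMDiff_traceShape (hφ : IsIsometricImmersion m φ) (hν : IsUnitNormal φ ν) :
    ContMDiff (𝓡 m) 𝓘(ℝ, ℝ) ∞ (traceShape φ ν) := by
  unfold traceShape
  refine ContMDiff.sum fun b _ => contMDiff_inner
    ((contMDiff_ambientShape hφ hν).clm_apply contMDiff_const) contMDiff_const

omit [IsManifold (𝓡 m) ∞ M] in
theorem ambientShape_dmap (hφ : IsIsometricImmersion m φ) (p : M) (u : TangentSpace (𝓡 m) p) :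
    ambientShape φ ν p (dmap φ p u) = -mvfderiv (𝓡 m) ν p u := by
  rw [ambientShape, neg_apply, tangentialDeriv_dmap hφ]

omit [IsManifold (𝓡 m) ∞ M] in
theorem ambientShape_eq_zero {p : M} {w : Ambient (m + 1)}
    (hw : ∀ u : TangentSpace (𝓡 m) p, ⟪dmap φ p u, w⟫ = 0) : ambientShape φ ν p w = 0 := by
  rw [ambientShape, neg_apply, tangentialDeriv_eq_zero _ _ hw, neg_zero]

omit [IsManifold (𝓡 m) ∞ M] [RiemannianBundle (fun p : M => TangentSpace (𝓡 m) p)] in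
theorem inner_mvfderiv_normal_self (hν : IsUnitNormal φ ν) (p : M) (u : TangentSpace (𝓡 m) p) :
    ⟪ν p, mvfderiv (𝓡 m) ν p u⟫ = 0 := by
  have hd := (hν.smooth p).mdifferentiableAt (by simp)
  have h := mvfderiv_inner hd hd u
  have h1 : (fun q => ⟪ν q, ν q⟫) = fun _ => (1 : ℝ) := by
    ext q; simp [hν.unit]
  rw [h1, mvfderiv_const, real_inner_comm, ← two_mul] at h
  simpa using h.symm

omit [IsManifold (𝓡 m) ∞ M] in
theorem inner_coe_mvfderiv_normal (hφ : IsIsometricImmersion m φ) (hν : IsUnitNormal φ ν) (p : M)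
    (u : TangentSpace (𝓡 m) p) : ⟪(φ p : Ambient (m + 1)), mvfderiv (𝓡 m) ν p u⟫ = 0 := by
  have h := mvfderiv_inner ((hφ.contMDiff_coe p).mdifferentiableAt (by simp))
    ((hν.smooth p).mdifferentiableAt (by simp)) u
  have h1 : (fun q => ⟪(φ q : Ambient (m + 1)), ν q⟫) = fun _ => (0 : ℝ) := by
    ext q; exact hν.tangent_sphere q
  rw [h1, mvfderiv_const] at h
  have h2 : ⟪mvfderiv (𝓡 m) (fun q => (φ q : Ambient (m + 1))) p u, ν p⟫ = 0 := hν.normal p u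
  rw [h2, zero_add] at h
  exact h.symm

theorem inner_coordHess_normal (hφ : IsIsometricImmersion m φ) (hν : IsUnitNormal φ ν) (p : M)
    (u v : TangentSpace (𝓡 m) p) :
    ⟪coordHess φ p u v, ν p⟫ = -⟪dmap φ p v, mvfderiv (𝓡 m) ν p u⟫ := by
  have h := mvfderiv_inner (mdifferentiableAt_dmap_coordField hφ p v)
    ((hν.smooth p).mdifferentiableAt (by simp)) u
  have h1 : (fun q => ⟪dmap φ q (coordField p v q), ν q⟫) = fun _ => (0 : ℝ) := by
    ext q; exact hν.normal q _
  rw [h1, mvfderiv_const, coordField_self] at h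
  exact eq_neg_of_add_eq_zero_left h.symm

/-- Differentiating ⟨dφ V, ν⟩ = 0 turns both sides into normal components of `coordHess`, which is
symmetric. -/
theorem inner_ambientShape_dmap_comm (hφ : IsIsometricImmersion m φ) (hν : IsUnitNormal φ ν)
    (p : M) (u v : TangentSpace (𝓡 m) p) :
    ⟪ambientShape φ ν p (dmap φ p u), dmap φ p v⟫ =
      ⟪dmap φ p u, ambientShape φ ν p (dmap φ p v)⟫ := by
  rw [ambientShape_dmap hφ, ambientShape_dmap hφ, inner_neg_left, inner_neg_right, real_inner_comm,
    ← inner_coordHess_normal hφ hν, ← inner_coordHess_normal hφ hν, coordHess_comm hφ]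

omit [IsManifold (𝓡 m) ∞ M] in
theorem exists_decomposition (hφ : IsIsometricImmersion m φ) (hν : IsUnitNormal φ ν) (p : M)
    (w : Ambient (m + 1)) : ∃ u : TangentSpace (𝓡 m) p,
      w = dmap φ p u + ⟪ν p, w⟫ • ν p + ⟪(φ p : Ambient (m + 1)), w⟫ • (φ p : Ambient (m + 1)) := by
  refine ⟨sharp p fun u => ⟪dmap φ p u, w⟫, ?_⟩
  have h2 : ⟪ν p, ν p⟫ = 1 := by rw [real_inner_self_eq_norm_sq, hν.unit]; norm_num
  have h3 : ⟪ν p, (φ p : Ambient (m + 1))⟫ = 0 := by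
    rw [real_inner_comm, hν.tangent_sphere]
  have h4 : ∀ u : TangentSpace (𝓡 m) p, ⟪ν p, dmap φ p u⟫ = 0 := fun u => by
    rw [real_inner_comm, hν.normal]
  have h5 : ∀ u : TangentSpace (𝓡 m) p, ⟪dmap φ p u, (φ p : Ambient (m + 1))⟫ = 0 := fun u => by
    rw [real_inner_comm, inner_coe_dmap hφ]
  rw [← sub_eq_zero]
  refine eq_zero_of_inner_eq_zero hφ hν (p := p) (fun u => ?_) ?_ ?_
  · rw [inner_sub_right, inner_add_right, inner_add_right, real_inner_smul_right,
      real_inner_smul_right, hν.normal, h5, hφ.isometric,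
      real_inner_comm (sharp p fun u => ⟪dmap φ p u, w⟫) u, inner_sharp]
    · ring
    · exact ⟨fun x y => by rw [map_add, inner_add_left],
        fun c x => by rw [map_smul, real_inner_smul_left, smul_eq_mul]⟩
  · rw [inner_sub_right, inner_add_right, inner_add_right, real_inner_smul_right,
      real_inner_smul_right, h2, h3, h4]
    ring
  · rw [inner_sub_right, inner_add_right, inner_add_right, real_inner_smul_right,
      real_inner_smul_right, hν.tangent_sphere, inner_coe_dmap hφ, real_inner_self_eq_norm_sq,
      norm_coe_sph]
    ring

omit [IsManifold (𝓡 m) ∞ M] in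
theorem ambientShape_normal (hν : IsUnitNormal φ ν) (p : M) : ambientShape φ ν p (ν p) = 0 :=
  ambientShape_eq_zero (hν.normal p)

omit [IsManifold (𝓡 m) ∞ M] in
theorem ambientShape_coe (hφ : IsIsometricImmersion m φ) (p : M) :
    ambientShape φ ν p (φ p) = 0 :=
  ambientShape_eq_zero fun u => by rw [real_inner_comm, inner_coe_dmap hφ]

/-- The operator kills ν and φ and its image is orthogonal to both, so symmetry reduces to tangent
vectors. -/
theorem inner_ambientShape_comm (hφ : IsIsometricImmersion m φ) (hν : IsUnitNormal φ ν) (p : M)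
    (w w' : Ambient (m + 1)) :
    ⟪ambientShape φ ν p w, w'⟫ = ⟪w, ambientShape φ ν p w'⟫ := by
  have hn : ∀ u : TangentSpace (𝓡 m) p, ⟪ambientShape φ ν p (dmap φ p u), ν p⟫ = 0 := fun u => by
    rw [ambientShape_dmap hφ, inner_neg_left, real_inner_comm, inner_mvfderiv_normal_self hν,
      neg_zero]
  have hx : ∀ u : TangentSpace (𝓡 m) p,
      ⟪ambientShape φ ν p (dmap φ p u), (φ p : Ambient (m + 1))⟫ = 0 := fun u => by
    rw [ambientShape_dmap hφ, inner_neg_left, real_inner_comm, inner_coe_mvfderiv_normal hφ hν,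
      neg_zero]
  obtain ⟨u, hu⟩ := exists_decomposition hφ hν p w
  obtain ⟨u', hu'⟩ := exists_decomposition hφ hν p w'
  have hw : ambientShape φ ν p w = ambientShape φ ν p (dmap φ p u) := by
    conv_lhs => rw [hu]
    simp [ambientShape_normal hν, ambientShape_coe hφ]
  have hw' : ambientShape φ ν p w' = ambientShape φ ν p (dmap φ p u') := by
    conv_lhs => rw [hu']
    simp [ambientShape_normal hν, ambientShape_coe hφ]
  rw [hw, hw', hu, hu', inner_add_left, inner_add_left, inner_add_right, inner_add_right,
    real_inner_smul_right, real_inner_smul_right, real_inner_smul_left, real_inner_smul_left,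
    hn, hx, real_inner_comm (ambientShape φ ν p (dmap φ p u')) (ν p), hn,
    real_inner_comm (ambientShape φ ν p (dmap φ p u')) (φ p : Ambient (m + 1)), hx,
    inner_ambientShape_dmap_comm hφ hν]
  ring

omit [IsManifold (𝓡 m) ∞ M] in
-- The operator is a sum of rank-one maps ⟨dφ eᵢ, ·⟩ (−Dν eᵢ), and the trace of a rank-one map is
-- the pairing of its two vectors.
theorem sum_inner_ambientShape (p : M) : ∑ i, -⟪dmap φ p (onb (m := m) p i),
    mvfderiv (𝓡 m) ν p (onb p i)⟫ = traceShape φ ν p := by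
  unfold traceShape ambientShape
  simp_rw [neg_apply, tangentialDeriv_apply, inner_neg_left, sum_inner, real_inner_smul_left,
    Finset.sum_neg_distrib]
  rw [Finset.sum_comm]
  congr 1
  refine Finset.sum_congr rfl fun i _ => ?_
  rw [← (EuclideanSpace.basisFun (Fin (m + 1 + 1)) ℝ).sum_inner_mul_inner]
  exact Finset.sum_congr rfl fun b _ => by rw [real_inner_comm (mvfderiv _ _ _ _)]

omit [IsManifold (𝓡 m) ∞ M] in
theorem inner_pullbackConn_dmap {W : M → Ambient (m + 1)} (hφ : IsIsometricImmersion m φ) (p : M)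
    (u w : TangentSpace (𝓡 m) p) :
    ⟪pullbackConn φ W p u, dmap φ p w⟫ = ⟪mvfderiv (𝓡 m) W p u, dmap φ p w⟫ :=
  inner_tanProj_of_orthogonal (inner_coe_dmap hφ p w)

omit [IsManifold (𝓡 m) ∞ M] in
theorem inner_shapeOperator (hφ : IsIsometricImmersion m φ) (p : M) (u w : TangentSpace (𝓡 m) p) :
    ⟪shapeOperator φ ν p u, w⟫ = ⟪ambientShape φ ν p (dmap φ p u), dmap φ p w⟫ := by
  rw [shapeOperator, inner_sharp, inner_pullbackConn_dmap hφ, ambientShape_dmap hφ, inner_neg_left]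
  exact ⟨fun x y => by rw [map_add, inner_add_right, neg_add],
    fun c x => by rw [map_smul, real_inner_smul_right, smul_eq_mul]; ring⟩

omit [IsManifold (𝓡 m) ∞ M] in
theorem meanCurvature_eq (hφ : IsIsometricImmersion m φ) (p : M) :
    meanCurvature φ ν p = traceShape φ ν p / m := by
  rw [meanCurvature, ← sum_inner_ambientShape]
  congr 1
  refine Finset.sum_congr rfl fun i _ => ?_
  rw [inner_shapeOperator hφ, ambientShape_dmap hφ, inner_neg_left, real_inner_comm]

omit [IsManifold (𝓡 m) ∞ M] in
theorem nat_mul_meanCurvature (hφ : IsIsometricImmersion m φ) (p : M) :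
    m * meanCurvature φ ν p = traceShape φ ν p := by
  rw [meanCurvature_eq hφ]
  -- For m = 0 the quotient by m is 0 by convention, and the trace is an empty sum.
  rcases Nat.eq_zero_or_pos m with hm | hm
  · have : IsEmpty (Fin (Module.finrank ℝ (TangentSpace (𝓡 m) p))) := by
      rw [finrank_tangentSpace, hm]; infer_instance
    rw [← sum_inner_ambientShape, Finset.univ_eq_empty, Finset.sum_empty]; simp
  · field_simp

/-- The tension field of a hypersurface is `m f ν`. -/
theorem tension_eq (hφ : IsIsometricImmersion m φ) (hν : IsUnitNormal φ ν) (p : M) :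
    tension m φ p = traceShape φ ν p • ν p := by
  rw [tension, ← sum_inner_ambientShape, Finset.sum_smul]
  refine Finset.sum_congr rfl fun i _ => ?_
  rw [← inner_coordHess_normal hφ hν, ← sub_eq_zero]
  have h2 : ⟪ν p, ν p⟫ = 1 := by rw [real_inner_self_eq_norm_sq, hν.unit]; norm_num
  -- The tangential component vanishes by the Gauss formula, the radial one by the projection; only
  -- the ν-component remains.
  refine eq_zero_of_inner_eq_zero hφ hν (p := p) (fun u => ?_) ?_ ?_
  · rw [real_inner_comm, inner_sub_left, inner_sub_left, inner_pullbackConn_dmap hφ,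
      real_inner_smul_left, real_inner_comm _ (ν p), hν.normal, hφ.isometric,
      ← inner_leviCivita_coordField hφ]
    simp [coordHess]
  · rw [real_inner_comm, inner_sub_left, inner_sub_left, pullbackConn,
      inner_tanProj_of_orthogonal (hν.tangent_sphere p), hν.normal, real_inner_smul_left, h2]
    simp [coordHess]
  · rw [inner_sub_right, inner_sub_right, pullbackConn, inner_tanProj_self, inner_coe_dmap hφ,
      real_inner_smul_right, hν.tangent_sphere]
    simp

end Hypersurface

/-! ### Killing fields of the sphere are linear -/

section Killing

variable {n : ℕ} {X : ∀ x : Sph n, TangentSpace (𝓡 n) x}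

theorem range_mvfderiv_coe_sph (x : Sph n) :
    (mvfderiv (𝓡 n) (fun y : Sph n => (y : Ambient n)) x).range = (ℝ ∙ (x : Ambient n))ᗮ :=
  have := Fact.mk (@finrank_euclideanSpace_fin ℝ _ (n + 1))
  range_mvfderiv_subtypeVal x

theorem inner_coe_mvfderiv_coe (x : Sph n) (v : TangentSpace (𝓡 n) x) :
    ⟪(x : Ambient n), mvfderiv (𝓡 n) (fun y : Sph n => (y : Ambient n)) x v⟫ = 0 := by
  have h : mvfderiv (𝓡 n) (fun y : Sph n => (y : Ambient n)) x v ∈ (ℝ ∙ (x : Ambient n))ᗮ := by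
    rw [← range_mvfderiv_coe_sph]
    exact ⟨v, rfl⟩
  exact Submodule.mem_orthogonal_singleton_iff_inner_right.1 h

theorem exists_mvfderiv_coe_eq (x : Sph n) {w : Ambient n} (hw : ⟪(x : Ambient n), w⟫ = 0) :
    ∃ v : TangentSpace (𝓡 n) x, mvfderiv (𝓡 n) (fun y : Sph n => (y : Ambient n)) x v = w := by
  have h : w ∈ (ℝ ∙ (x : Ambient n))ᗮ := Submodule.mem_orthogonal_singleton_iff_inner_right.2 hw
  rwa [← range_mvfderiv_coe_sph] at h

theorem IsKilling.contMDiff_toAmbient (hX : IsKilling X) :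
    ContMDiff (𝓡 n) 𝓘(ℝ, Ambient n) ∞ (toAmbient X) := by
  have h := (contMDiff_coe_sph (n := n)).contMDiff_tangentMap (m := ∞) (by simp)
  exact (contMDiff_snd_tangentBundle_modelSpace (Ambient n) 𝓘(ℝ, Ambient n)).comp
    (h.comp hX.smooth)

/-- The extension of a vector field on the sphere to the ambient space that is homogeneous of
degree one. -/
def homExt (X : ∀ x : Sph n, TangentSpace (𝓡 n) x) (y : Ambient n) : Ambient n :=
  if h : y = 0 then 0 else
    ‖y‖ • toAmbient X ⟨‖y‖⁻¹ • y, by simpa using norm_smul_inv_norm (𝕜 := ℝ) h⟩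

theorem homExt_coe (x : Sph n) : homExt X (x : Ambient n) = toAmbient X x := by
  have h : (x : Ambient n) ≠ 0 := ne_zero_of_mem_unit_sphere x
  rw [homExt, dif_neg h]
  refine (congrArg₂ (· • ·) (norm_coe_sph x) (congrArg (toAmbient X) (Subtype.ext ?_))).trans
    (one_smul ℝ _)
  simp

theorem homExt_smul {r : ℝ} (hr : 0 < r) (y : Ambient n) : homExt X (r • y) = r • homExt X y := by
  by_cases h : y = 0
  · simp [homExt, h]
  · have h' : r • y ≠ 0 := smul_ne_zero hr.ne' h
    have hn : ‖r • y‖ = r * ‖y‖ := by rw [norm_smul, Real.norm_of_nonneg hr.le]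
    rw [homExt, dif_neg h', homExt, dif_neg h, smul_smul r ‖y‖]
    refine congrArg₂ (· • ·) hn (congrArg (toAmbient X) (Subtype.ext ?_))
    simp only [hn, smul_smul]
    congr 1
    field_simp

theorem exists_smul_sph {y : Ambient n} (hy : y ≠ 0) :
    ∃ (r : ℝ) (x : Sph n), 0 < r ∧ y = r • (x : Ambient n) :=
  ⟨‖y‖, ⟨‖y‖⁻¹ • y, by simpa using norm_smul_inv_norm (𝕜 := ℝ) hy⟩, norm_pos_iff.2 hy, by
    simp [smul_smul, hy]⟩

theorem IsKilling.contDiffAt_homExt (hX : IsKilling X) {y : Ambient n} (hy : y ≠ 0) :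
    ContDiffAt ℝ ∞ (homExt X) y := by
  have := Fact.mk (@finrank_euclideanSpace_fin ℝ _ (n + 1))
  let U : TopologicalSpace.Opens (Ambient n) := ⟨{0}ᶜ, isOpen_compl_singleton⟩
  have hc : ContMDiff 𝓘(ℝ, Ambient n) 𝓘(ℝ, Ambient n) ∞ (fun z : U => (z : Ambient n)) :=
    contMDiff_subtype_val
  have hn : ContMDiff 𝓘(ℝ, Ambient n) 𝓘(ℝ, ℝ) ∞ (fun z : U => ‖(z : Ambient n)‖) := fun z =>
    (contDiffAt_norm ℝ z.2).contMDiffAt.comp z (hc z)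
  have hn' : ContMDiff 𝓘(ℝ, Ambient n) 𝓘(ℝ, ℝ) ∞ (fun z : U => ‖(z : Ambient n)‖⁻¹) := fun z =>
    (contDiffAt_inv ℝ (norm_ne_zero_iff.2 z.2)).contMDiffAt.comp z (hn z)
  have hp := (hn'.smul hc).codRestrict_sphere (n := n) (fun z : U => by
    simpa using norm_smul_inv_norm (𝕜 := ℝ) z.2)
  have h1 : ContMDiff 𝓘(ℝ, Ambient n) 𝓘(ℝ, Ambient n) ∞
      (fun z : U => homExt X (z : Ambient n)) := by
    refine (hn.smul (hX.contMDiff_toAmbient.comp hp)).congr fun z => ?_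
    have hz : (z : Ambient n) ≠ 0 := z.2
    rw [homExt, dif_neg hz]
    rfl
  exact (contMDiffAt_subtype_iff.1 (h1 ⟨y, hy⟩)).contDiffAt

/-- The derivative is homogeneous of degree zero, so statements about it need checking only on the
unit sphere. -/
theorem IsKilling.fderiv_homExt_smul (hX : IsKilling X) {r : ℝ} (hr : 0 < r) {y : Ambient n}
    (hy : y ≠ 0) : fderiv ℝ (homExt X) (r • y) = fderiv ℝ (homExt X) y := by
  have h1 := (hX.contDiffAt_homExt hy).differentiableAt (by simp)
  have h2 := (hX.contDiffAt_homExt (smul_ne_zero hr.ne' hy)).differentiableAt (by simp)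
  have h3 := (h2.hasFDerivAt.comp y ((hasFDerivAt_id y).const_smul r)).fderiv
  have h4 : homExt X ∘ (fun z => r • id z) = fun z => r • homExt X z := by
    ext1 z; exact homExt_smul hr z
  have h5 := (h1.hasFDerivAt.const_smul r).fderiv
  ext1 v
  have h6 : fderiv ℝ (fun z => r • homExt X z) y v = fderiv ℝ (homExt X) (r • y) (r • v) :=
    congrArg (fun L => L v) ((congrArg (fun g => fderiv ℝ g y) h4.symm).trans h3)
  have h7 : fderiv ℝ (fun z => r • homExt X z) y v = r • fderiv ℝ (homExt X) y v :=
    congrArg (fun L => L v) h5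
  rw [h7, map_smul] at h6
  exact (smul_right_injective _ hr.ne' h6).symm

/-- Euler's relation for degree one, from differentiating t ↦ homExt (t y) at t = 1. -/
theorem IsKilling.fderiv_homExt_self (hX : IsKilling X) {y : Ambient n} (hy : y ≠ 0) :
    fderiv ℝ (homExt X) y y = homExt X y := by
  have h1 := (hX.contDiffAt_homExt hy).differentiableAt (by simp)
  have hl : HasDerivAt (fun t : ℝ => t • y) y 1 := by
    simpa using (hasDerivAt_id (1 : ℝ)).smul_const y
  have h2 : HasDerivAt (fun t : ℝ => homExt X (t • y)) (fderiv ℝ (homExt X) y y) 1 := by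
    have h1' : HasFDerivAt (homExt X) (fderiv ℝ (homExt X) y) ((1 : ℝ) • y) := by
      rw [one_smul]; exact h1.hasFDerivAt
    exact h1'.comp_hasDerivAt (1 : ℝ) hl
  have h3 : HasDerivAt (fun t : ℝ => t • homExt X y) (homExt X y) 1 := by
    simpa using (hasDerivAt_id (1 : ℝ)).smul_const (homExt X y)
  refine h2.unique (h3.congr_of_eventuallyEq ?_)
  filter_upwards [lt_mem_nhds one_pos] with t ht
  exact homExt_smul ht y

theorem inner_homExt_self (y : Ambient n) : ⟪homExt X y, y⟫ = 0 := by
  by_cases hy : y = 0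
  · rw [hy, inner_zero_right]
  · obtain ⟨r, x, hr, rfl⟩ := exists_smul_sph hy
    rw [homExt_smul hr, homExt_coe, real_inner_smul_left, real_inner_smul_right, real_inner_comm,
      toAmbient, inner_coe_mvfderiv_coe, mul_zero, mul_zero]

theorem IsKilling.inner_fderiv_homExt_right (hX : IsKilling X) {y : Ambient n} (hy : y ≠ 0)
    (v : Ambient n) : ⟪fderiv ℝ (homExt X) y v, y⟫ = -⟪homExt X y, v⟫ := by
  have h1 := (hX.contDiffAt_homExt hy).differentiableAt (by simp)
  have h2 := fderiv_inner_apply ℝ h1 differentiableAt_id v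
  have h3 : (fun z => ⟪homExt X z, id z⟫) = fun _ => (0 : ℝ) := by
    ext1 z; exact inner_homExt_self z
  rw [h3] at h2
  simp at h2
  linarith

/-- The derivative of the homogeneous extension of a Killing field is skew. -/
theorem IsKilling.inner_fderiv_homExt (hX : IsKilling X) {y : Ambient n} (hy : y ≠ 0)
    (v w : Ambient n) :
    ⟪fderiv ℝ (homExt X) y v, w⟫ + ⟪v, fderiv ℝ (homExt X) y w⟫ = 0 := by
  obtain ⟨r, x, hr, rfl⟩ := exists_smul_sph hy
  have hx : (x : Ambient n) ≠ 0 := ne_zero_of_mem_unit_sphere x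
  rw [hX.fderiv_homExt_smul hr hx]
  have h1 := (hX.contDiffAt_homExt hx).differentiableAt (by simp)
  have hD : ∀ v : TangentSpace (𝓡 n) x, mvfderiv (𝓡 n) (toAmbient X) x v =
      fderiv ℝ (homExt X) x (mvfderiv (𝓡 n) (fun y : Sph n => (y : Ambient n)) x v) := by
    intro v
    rw [← mvfderiv_comp_left h1.hasFDerivAt ((contMDiff_coe_sph x).mdifferentiableAt (by simp))]
    simp_rw [homExt_coe]
  have htan : ∀ v w : Ambient n, ⟪(x : Ambient n), v⟫ = 0 → ⟪(x : Ambient n), w⟫ = 0 →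
      ⟪fderiv ℝ (homExt X) x v, w⟫ + ⟪v, fderiv ℝ (homExt X) x w⟫ = 0 := by
    intro v w hv hw
    obtain ⟨v', rfl⟩ := exists_mvfderiv_coe_eq x hv
    obtain ⟨w', rfl⟩ := exists_mvfderiv_coe_eq x hw
    have h := hX.killing x v' w'
    rwa [sphereConn, sphereConn, inner_tanProj_of_orthogonal hw, inner_tanProj_of_orthogonal hv,
      hD, hD, real_inner_comm (mvfderiv _ _ _ v')] at h
  -- The Killing equation covers tangent pairs. Pairs with a radial vector are handled by Euler's
  -- relation and by differentiating ⟨homExt y, y⟩ = 0.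
  have hdec : ∀ v : Ambient n, ∃ v₀ a, ⟪(x : Ambient n), v₀⟫ = 0 ∧ v = v₀ + a • (x : Ambient n) :=
    fun v => ⟨tanProj x v, ⟪(x : Ambient n), v⟫, inner_tanProj_self x v, by simp [tanProj]⟩
  obtain ⟨v₀, a, hv, rfl⟩ := hdec v
  obtain ⟨w₀, b, hw, rfl⟩ := hdec w
  have h2 := htan v₀ w₀ hv hw
  have h3 := hX.inner_fderiv_homExt_right hx v₀
  have h4 := hX.inner_fderiv_homExt_right hx w₀
  have h5 := inner_homExt_self (X := X) (x : Ambient n)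
  simp only [map_add, map_smul, hX.fderiv_homExt_self hx, inner_add_left, inner_add_right,
    real_inner_smul_left, real_inner_smul_right, h3, h5, real_inner_comm (homExt X (x : Ambient n)),
    real_inner_comm (fderiv ℝ (homExt X) (x : Ambient n) w₀) (x : Ambient n), h4]
  linarith

/-- A trilinear form symmetric in its first two arguments and skew in its last two is zero; here the
skewness comes from differentiating that of the first derivative. -/
theorem IsKilling.fderiv_fderiv_homExt (hX : IsKilling X) {y : Ambient n} (hy : y ≠ 0) :
    fderiv ℝ (fderiv ℝ (homExt X)) y = 0 := by
  have hs : IsSymmSndFDerivAt ℝ (homExt X) y :=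
    (hX.contDiffAt_homExt hy).isSymmSndFDerivAt (by simpa using ENat.LEInfty.out)
  have hd : DifferentiableAt ℝ (fderiv ℝ (homExt X)) y :=
    ((hX.contDiffAt_homExt hy).fderiv_right (m := ∞) (by simp)).differentiableAt (by simp)
  have hskew : ∀ a b c : Ambient n, ⟪fderiv ℝ (fderiv ℝ (homExt X)) y a b, c⟫ =
      -⟪fderiv ℝ (fderiv ℝ (homExt X)) y a c, b⟫ := by
    intro a b c
    have hb : HasFDerivAt (fun z => fderiv ℝ (homExt X) z b) _ y :=
      ((ContinuousLinearMap.apply ℝ (Ambient n) b).hasFDerivAt).comp y hd.hasFDerivAt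
    have hc : HasFDerivAt (fun z => fderiv ℝ (homExt X) z c) _ y :=
      ((ContinuousLinearMap.apply ℝ (Ambient n) c).hasFDerivAt).comp y hd.hasFDerivAt
    have h1 := ((hb.inner ℝ (hasFDerivAt_const c y)).add
      ((hasFDerivAt_const b y).inner ℝ hc)).fderiv
    have h2 : (fun z => ⟪fderiv ℝ (homExt X) z b, c⟫) + (fun z => ⟪b, fderiv ℝ (homExt X) z c⟫)
        =ᶠ[nhds y] fun _ => (0 : ℝ) := by
      filter_upwards [isOpen_compl_singleton.mem_nhds hy] with z hz
      exact hX.inner_fderiv_homExt hz b c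
    rw [h2.fderiv_eq] at h1
    have h3 := congrArg (fun L => L a) h1
    simp at h3
    rw [real_inner_comm b]
    linarith
  ext1 a
  ext1 b
  refine ext_inner_right ℝ fun c => ?_
  have h : ∀ a b c : Ambient n, ⟪fderiv ℝ (fderiv ℝ (homExt X)) y a b, c⟫ =
      ⟪fderiv ℝ (fderiv ℝ (homExt X)) y b a, c⟫ := fun a b c => by rw [hs]
  have h1 := hskew a b c
  -- Alternating the two symmetries returns to the initial order of arguments with the opposite
  -- sign.
  rw [h a c b, hskew c a b, h c b a, hskew b c a, h b a c] at h1
  simp only [zero_apply, inner_zero_left]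
  linarith

/-- Killing fields of the round sphere are restrictions of skew endomorphisms. -/
theorem IsKilling.exists_skew (hX : IsKilling X) (hn : 1 ≤ n) :
    ∃ K : Ambient n →L[ℝ] Ambient n, (∀ v w, ⟪K v, w⟫ + ⟪v, K w⟫ = 0) ∧
      ∀ x : Sph n, toAmbient X x = K x := by
  obtain ⟨x₀, hx₀⟩ : ∃ x₀ : Ambient n, x₀ ≠ 0 := exists_ne 0
  -- Here n ≥ 1 enters: the ambient dimension is at least 2, so removing the origin leaves a
  -- connected set, on which the derivative is constant.
  have hconn : IsPreconnected ({0}ᶜ : Set (Ambient n)) := by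
    refine (isConnected_compl_singleton_of_one_lt_rank ?_ 0).isPreconnected
    rw [← Module.finrank_eq_rank, finrank_euclideanSpace_fin]
    exact_mod_cast Nat.lt_succ_of_le hn
  refine ⟨fderiv ℝ (homExt X) x₀, fun v w => hX.inner_fderiv_homExt hx₀ v w, fun x => ?_⟩
  have hx : (x : Ambient n) ≠ 0 := ne_zero_of_mem_unit_sphere x
  have h : fderiv ℝ (homExt X) x₀ = fderiv ℝ (homExt X) x := by
    refine isOpen_compl_singleton.is_const_of_fderiv_eq_zero hconn (fun y hy => ?_)
      (fun y hy => hX.fderiv_fderiv_homExt hy) hx₀ hx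
    exact (((hX.contDiffAt_homExt hy).fderiv_right (m := ∞) (by simp)).differentiableAt
      (by simp)).differentiableWithinAt
  rw [h, hX.fderiv_homExt_self hx, homExt_coe]

end Killing

/-! ### The bitension field of a hypersurface -/

section Current

variable {m : ℕ} {M : Type*} [TopologicalSpace M] [ChartedSpace (EuclideanSpace ℝ (Fin m)) M]
  [IsManifold (𝓡 m) ∞ M] [RiemannianBundle (fun p : M => TangentSpace (𝓡 m) p)]
  {φ : M → Sph (m + 1)} {ν : M → Ambient (m + 1)}

theorem inner_ambientShape_normal (hφ : IsIsometricImmersion m φ) (hν : IsUnitNormal φ ν) (p : M)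
    (w : Ambient (m + 1)) : ⟪ambientShape φ ν p w, ν p⟫ = 0 := by
  rw [inner_ambientShape_comm hφ hν, ambientShape_normal hν, inner_zero_right]

theorem inner_ambientShape_coe (hφ : IsIsometricImmersion m φ) (hν : IsUnitNormal φ ν) (p : M)
    (w : Ambient (m + 1)) : ⟪ambientShape φ ν p w, (φ p : Ambient (m + 1))⟫ = 0 := by
  rw [inner_ambientShape_comm hφ hν, ambientShape_coe hφ, inner_zero_right]

theorem dmap_shapeOperator (hφ : IsIsometricImmersion m φ) (hν : IsUnitNormal φ ν) (p : M)
    (u : TangentSpace (𝓡 m) p) :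
    dmap φ p (shapeOperator φ ν p u) = ambientShape φ ν p (dmap φ p u) := by
  rw [← sub_eq_zero]
  refine eq_zero_of_inner_eq_zero hφ hν (p := p) (fun w => ?_) ?_ ?_
  · rw [real_inner_comm, inner_sub_left, hφ.isometric, inner_shapeOperator hφ, sub_self]
  · rw [real_inner_comm, inner_sub_left, hν.normal, inner_ambientShape_normal hφ hν, sub_self]
  · rw [inner_sub_right, inner_coe_dmap hφ, real_inner_comm, inner_ambientShape_coe hφ hν, sub_self]

theorem mvfderiv_ambientShape_comm (hφ : IsIsometricImmersion m φ) (hν : IsUnitNormal φ ν) (p : M)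
    (u : TangentSpace (𝓡 m) p) (w w' : Ambient (m + 1)) :
    ⟪mvfderiv (𝓡 m) (ambientShape φ ν) p u w, w'⟫ =
      ⟪w, mvfderiv (𝓡 m) (ambientShape φ ν) p u w'⟫ := by
  have hB := (contMDiff_ambientShape hφ hν p).mdifferentiableAt (by simp)
  have hc : ∀ w : Ambient (m + 1), MDifferentiableAt (𝓡 m) 𝓘(ℝ, Ambient (m + 1))
    (fun _ : M => w) p := fun w => mdifferentiableAt_const
  have h1 := mvfderiv_inner (hB.clm_apply (hc w)) (hc w') u
  have h2 := mvfderiv_inner (hc w) (hB.clm_apply (hc w')) u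
  simp_rw [inner_ambientShape_comm hφ hν, h2, mvfderiv_clm_apply hB (hc _), mvfderiv_const] at h1
  simpa using h1.symm

/-- The derivative of the trace of the shape operator, as a linear form on the ambient space. -/
def traceShapeDeriv (φ : M → Sph (m + 1)) (ν : M → Ambient (m + 1)) (q : M) :
    Ambient (m + 1) →L[ℝ] ℝ :=
  tangentialDeriv m φ (traceShape φ ν) q

theorem contMDiff_traceShapeDeriv (hφ : IsIsometricImmersion m φ) (hν : IsUnitNormal φ ν) :
    ContMDiff (𝓡 m) 𝓘(ℝ, Ambient (m + 1) →L[ℝ] ℝ) ∞ (traceShapeDeriv φ ν) :=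
  contMDiff_tangentialDeriv hφ (contMDiff_traceShape hφ hν)

/-- The image of the gradient of the trace of the shape operator in the ambient space. -/
def traceShapeGrad (φ : M → Sph (m + 1)) (ν : M → Ambient (m + 1)) (q : M) : Ambient (m + 1) :=
  adjointL (Ambient (m + 1)) ℝ (traceShapeDeriv φ ν q) 1

/-- Writing the Riesz representative as the adjoint evaluated at 1 makes it a continuous linear
function of the form, hence smooth. -/
theorem contMDiff_traceShapeGrad (hφ : IsIsometricImmersion m φ) (hν : IsUnitNormal φ ν) :
    ContMDiff (𝓡 m) 𝓘(ℝ, Ambient (m + 1)) ∞ (traceShapeGrad φ ν) :=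
  ((adjointL (Ambient (m + 1)) ℝ).contMDiff.comp (contMDiff_traceShapeDeriv hφ hν)).clm_apply
    contMDiff_const

omit [IsManifold (𝓡 m) ∞ M] in
theorem inner_traceShapeGrad (q : M) (w : Ambient (m + 1)) :
    ⟪traceShapeGrad φ ν q, w⟫ = traceShapeDeriv φ ν q w := by
  change ⟪ContinuousLinearMap.adjoint (traceShapeDeriv φ ν q) 1, w⟫ = _
  rw [ContinuousLinearMap.adjoint_inner_left]
  simp

theorem inner_mvfderiv_traceShapeGrad (hφ : IsIsometricImmersion m φ) (hν : IsUnitNormal φ ν)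
    (p : M) (u : TangentSpace (𝓡 m) p) (w : Ambient (m + 1)) :
    ⟪mvfderiv (𝓡 m) (traceShapeGrad φ ν) p u, w⟫ =
      mvfderiv (𝓡 m) (traceShapeDeriv φ ν) p u w := by
  have hc : MDifferentiableAt (𝓡 m) 𝓘(ℝ, Ambient (m + 1)) (fun _ : M => w) p :=
    mdifferentiableAt_const
  have h1 := mvfderiv_inner ((contMDiff_traceShapeGrad hφ hν p).mdifferentiableAt (by simp)) hc u
  simp_rw [inner_traceShapeGrad] at h1
  rw [mvfderiv_clm_apply ((contMDiff_traceShapeDeriv hφ hν p).mdifferentiableAt (by simp)) hc,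
    mvfderiv_const] at h1
  simpa using h1.symm

/-- Product rule for H ν. Both ν and its derivative are orthogonal to the position vector, so the
projection changes nothing. -/
theorem pullbackConn_tension (hφ : IsIsometricImmersion m φ) (hν : IsUnitNormal φ ν) (q : M)
    (u : TangentSpace (𝓡 m) q) :
    pullbackConn φ (tension m φ) q u = traceShapeDeriv φ ν q (dmap φ q u) • ν q -
      traceShape φ ν q • ambientShape φ ν q (dmap φ q u) := by
  have h : tension m φ = fun q => traceShape φ ν q • ν q := funext (tension_eq hφ hν)
  rw [pullbackConn, h, mvfderiv_smul_apply
    ((contMDiff_traceShape hφ hν q).mdifferentiableAt (by simp))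
    ((hν.smooth q).mdifferentiableAt (by simp)), tanProj, inner_add_right, real_inner_smul_right,
    real_inner_smul_right, hν.tangent_sphere, inner_coe_mvfderiv_normal hφ hν, traceShapeDeriv,
    tangentialDeriv_dmap hφ, ambientShape_dmap hφ]
  simp

/-- The biharmonic equation of a hypersurface, paired with a vector tangent to the sphere. -/
theorem inner_bitension (hφ : IsIsometricImmersion m φ) (hν : IsUnitNormal φ ν) (p : M)
    {v : Ambient (m + 1)} (hv : ⟪(φ p : Ambient (m + 1)), v⟫ = 0) :
    ⟪bitension m φ p, v⟫ = ∑ i,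
      (mvfderiv (𝓡 m) (traceShapeDeriv φ ν) p (onb p i) (dmap φ p (onb p i)) * ⟪ν p, v⟫ -
        2 * (traceShapeDeriv φ ν p (dmap φ p (onb p i)) *
          ⟪ambientShape φ ν p (dmap φ p (onb p i)), v⟫) -
        traceShape φ ν p *
          ⟪mvfderiv (𝓡 m) (ambientShape φ ν) p (onb p i) (dmap φ p (onb p i)), v⟫ +
        traceShape φ ν p * ⟪ν p, v⟫) := by
  rw [bitension, roughLaplacian]
  simp_rw [pullbackConn_tension hφ hν]
  rw [neg_neg, ← Finset.sum_sub_distrib, sum_inner]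
  refine Finset.sum_congr rfl fun i _ => ?_
  have hH := (contMDiff_traceShape hφ hν p).mdifferentiableAt (by simp)
  have hdH := (contMDiff_traceShapeDeriv hφ hν p).mdifferentiableAt (by simp)
  have hB := (contMDiff_ambientShape hφ hν p).mdifferentiableAt (by simp)
  have hN := (hν.smooth p).mdifferentiableAt (by simp)
  have hE := mdifferentiableAt_dmap_coordField hφ p (onb p i)
  -- By the Gauss formula this difference is orthogonal to the image of dφ. The shape operator and
  -- dH both kill it, which disposes of the connection correction in the rough Laplacian.
  have hS : ∀ u : TangentSpace (𝓡 m) p, ⟪dmap φ p u, coordHess φ p (onb p i) (onb p i) -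
      dmap φ p (leviCivita (coordField p (onb p i)) p (onb p i))⟫ = 0 := fun u => by
    rw [real_inner_comm, inner_sub_left, hφ.isometric, inner_leviCivita_coordField hφ, sub_self]
  have hS1 := ambientShape_eq_zero (ν := ν) hS
  have hS2 : traceShapeDeriv φ ν p _ = 0 := tangentialDeriv_eq_zero _ _ hS
  rw [map_sub, sub_eq_zero] at hS1 hS2
  have ht : ⟪dmap φ p (onb p i), dmap φ p (onb p i)⟫ = 1 := by
    rw [hφ.isometric, real_inner_self_eq_norm_sq, (onb p).norm_eq_one]; norm_num
  have h4 : MDifferentiableAt (𝓡 m) 𝓘(ℝ, Ambient (m + 1))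
      (fun q => traceShapeDeriv φ ν q (dmap φ q (coordField p (onb p i) q)) • ν q) p :=
    (hdH.clm_apply hE).smul hN
  have h5 : MDifferentiableAt (𝓡 m) 𝓘(ℝ, Ambient (m + 1)) (fun q => traceShape φ ν q •
      ambientShape φ ν q (dmap φ q (coordField p (onb p i) q))) p := hH.smul (hB.clm_apply hE)
  -- For a unit tangent vector t, R(t, Hν)t = −Hν, which is the source of the last summand.
  rw [tension_eq hφ hν, sphereCurvature_eq (φ p) (inner_coe_dmap hφ p _)
    (by rw [real_inner_smul_right, hν.tangent_sphere, mul_zero]) (inner_coe_dmap hφ p _), ht,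
    real_inner_smul_left, real_inner_comm _ (ν p), hν.normal, inner_sub_left, inner_sub_left,
    pullbackConn, inner_tanProj_of_orthogonal hv, mvfderiv_fun_sub h4 h5, sub_apply,
    mvfderiv_smul_apply (hdH.clm_apply hE) hN, mvfderiv_smul_apply hH (hB.clm_apply hE),
    mvfderiv_clm_apply hdH hE, mvfderiv_clm_apply hB hE, coordField_self]
  have h1 : mvfderiv (𝓡 m) (fun q => dmap φ q (coordField p (onb p i) q)) p (onb p i) =
    coordHess φ p (onb p i) (onb p i) := rfl
  have h2 : mvfderiv (𝓡 m) (traceShape φ ν) p (onb p i) =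
      traceShapeDeriv φ ν p (dmap φ p (onb p i)) := (tangentialDeriv_dmap hφ _ _ _).symm
  have h3 : mvfderiv (𝓡 m) ν p (onb p i) = -ambientShape φ ν p (dmap φ p (onb p i)) := by
    rw [ambientShape_dmap hφ, neg_neg]
  rw [h1, h2, h3, hS1, hS2]
  simp only [inner_sub_left, inner_add_left, real_inner_smul_left, inner_neg_left, smul_neg,
    add_smul, smul_add, zero_smul, mul_zero, one_smul, inner_zero_left]
  ring

/-! ### Divergence of the current of a Killing field -/

section Killing

variable {X : ∀ x : Sph (m + 1), TangentSpace (𝓡 (m + 1)) x}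
  {K : Ambient (m + 1) →L[ℝ] Ambient (m + 1)}

/-- The current of a Killing field in the ambient space. -/
theorem dmap_hypCurrent (hφ : IsIsometricImmersion m φ) (hν : IsUnitNormal φ ν)
    (hK : ∀ v w, ⟪K v, w⟫ + ⟪v, K w⟫ = 0) (hKX : ∀ x, toAmbient X x = K x) (p : M) :
    dmap φ p (hypCurrent φ ν X p) =
      traceShape φ ν p • (ambientShape φ ν p (K (φ p)) - K (ν p) -
        ⟪K (φ p), ν p⟫ • (φ p : Ambient (m + 1))) - ⟪K (φ p), ν p⟫ • traceShapeGrad φ ν p := by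
  rw [← sub_eq_zero]
  have hd := (hφ.contMDiff_coe p).mdifferentiableAt (by simp)
  have hf : MDifferentiableAt (𝓡 m) 𝓘(ℝ, ℝ) (meanCurvature φ ν) p := by
    have h : meanCurvature φ ν = fun q => (m : ℝ)⁻¹ • traceShape φ ν q := by
      ext1 q
      rw [meanCurvature_eq hφ, smul_eq_mul, div_eq_inv_mul]
    rw [h]
    exact mdifferentiableAt_const.smul ((contMDiff_traceShape hφ hν p).mdifferentiableAt (by simp))
  -- The current has no ν- or φ-component. On the right, ⟨Kν, ν⟩ = 0, and −⟨Kφ, ν⟩φ cancels the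
  -- radial part of −Kν.
  refine eq_zero_of_inner_eq_zero hφ hν (p := p) (fun u => ?_) ?_ ?_
  · have e1 : ⟪sharp p (fun u : TangentSpace (𝓡 m) p =>
        ⟪pullbackConn φ (fun q => toAmbient X (φ q)) p u, ν p⟫), u⟫ =
        -⟪K (ν p), dmap φ p u⟫ := by
      have h : ∀ u : TangentSpace (𝓡 m) p, ⟪pullbackConn φ (fun q => toAmbient X (φ q)) p u, ν p⟫ =
          -⟪K (ν p), dmap φ p u⟫ := by
        intro u
        simp_rw [hKX]
        rw [pullbackConn, inner_tanProj_of_orthogonal (hν.tangent_sphere p),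
          mvfderiv_comp_left K.hasFDerivAt hd]
        have := hK (dmap φ p u) (ν p)
        rw [real_inner_comm _ (dmap φ p u)] at this
        exact eq_neg_of_add_eq_zero_left this
      simp_rw [h]
      rw [inner_sharp]
      exact ⟨fun x y => by rw [map_add, inner_add_right, neg_add],
        fun c x => by rw [map_smul, real_inner_smul_right, smul_eq_mul]; ring⟩
    have e2 : ⟪sharp p (fun u : TangentSpace (𝓡 m) p =>
        ⟪toAmbient X (φ p), dmap φ p (shapeOperator φ ν p u)⟫), u⟫ =
        ⟪ambientShape φ ν p (K (φ p)), dmap φ p u⟫ := by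
      simp_rw [dmap_shapeOperator hφ hν, hKX, ← inner_ambientShape_comm hφ hν]
      rw [inner_sharp]
      exact ⟨fun x y => by rw [map_add, inner_add_right],
        fun c x => by rw [map_smul, real_inner_smul_right, smul_eq_mul]⟩
    have e3 : m * ⟪gradient (meanCurvature φ ν) p, u⟫ =
        ⟪traceShapeGrad φ ν p, dmap φ p u⟫ := by
      rw [gradient, inner_sharp, inner_traceShapeGrad, traceShapeDeriv, tangentialDeriv_dmap hφ]
      · have : traceShape φ ν = fun q => (m : ℝ) • meanCurvature φ ν q :=
          funext fun q => (nat_mul_meanCurvature hφ q).symm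
        rw [this, mvfderiv_smul_apply mdifferentiableAt_const hf, mvfderiv_const]
        simp
      · exact ⟨fun x y => by rw [map_add], fun c x => by rw [map_smul]⟩
    have h5 : ⟪dmap φ p u, (φ p : Ambient (m + 1))⟫ = 0 := by
      rw [real_inner_comm, inner_coe_dmap hφ]
    rw [inner_sub_right, hφ.isometric, hypCurrent, real_inner_comm _ u, inner_sub_left,
      inner_add_left, real_inner_smul_left, real_inner_smul_left, real_inner_smul_left, e1, e2,
      nat_mul_meanCurvature hφ, hKX]
    simp only [inner_sub_right, real_inner_smul_right, h5, real_inner_comm (dmap φ p u)] at e3 ⊢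
    linear_combination (-⟪K (φ p), ν p⟫) * e3
  · have h := hK (ν p) (ν p)
    rw [real_inner_comm (K (ν p)) (ν p), ← two_mul] at h
    rw [inner_sub_right, real_inner_comm, hν.normal, real_inner_comm]
    simp only [inner_sub_left, real_inner_smul_left, inner_ambientShape_normal hφ hν,
      hν.tangent_sphere, inner_traceShapeGrad]
    rw [show traceShapeDeriv φ ν p (ν p) = 0 from tangentialDeriv_eq_zero _ _ (hν.normal p)]
    linear_combination (traceShape φ ν p / 2) * h
  · have h := hK (ν p) (φ p)
    have h6 : traceShapeDeriv φ ν p (φ p) = 0 := tangentialDeriv_eq_zero _ _ fun u => by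
      rw [real_inner_comm, inner_coe_dmap hφ]
    rw [inner_sub_right, inner_coe_dmap hφ, real_inner_comm]
    simp only [inner_sub_left, real_inner_smul_left, inner_ambientShape_coe hφ hν,
      inner_traceShapeGrad, h6, real_inner_self_eq_norm_sq, norm_coe_sph]
    rw [real_inner_comm (K (φ p)) (ν p)] at h
    linear_combination (traceShape φ ν p) * h

theorem contMDiff_dmap_hypCurrent (hφ : IsIsometricImmersion m φ) (hν : IsUnitNormal φ ν)
    (hK : ∀ v w, ⟪K v, w⟫ + ⟪v, K w⟫ = 0) (hKX : ∀ x, toAmbient X x = K x) :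
    ContMDiff (𝓡 m) 𝓘(ℝ, Ambient (m + 1)) ∞ (fun p => dmap φ p (hypCurrent φ ν X p)) := by
  simp_rw [dmap_hypCurrent hφ hν hK hKX]
  have hF := hφ.contMDiff_coe
  have hKF := K.contDiff.contMDiff.comp hF
  have hh := contMDiff_inner hKF hν.smooth
  exact ((contMDiff_traceShape hφ hν).smul ((((contMDiff_ambientShape hφ hν).clm_apply hKF).sub
    (K.contDiff.contMDiff.comp hν.smooth)).sub (hh.smul hF))).sub
    (hh.smul (contMDiff_traceShapeGrad hφ hν))

/-- The divergence of the current is minus the bitension field paired with the Killing field. -/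
theorem divergence_hypCurrent (hφ : IsIsometricImmersion m φ) (hν : IsUnitNormal φ ν)
    (hK : ∀ v w, ⟪K v, w⟫ + ⟪v, K w⟫ = 0) (hKX : ∀ x, toAmbient X x = K x) (p : M) :
    divergence (hypCurrent φ ν X) p = -⟪bitension m φ p, K (φ p)⟫ := by
  have hxK : ⟪(φ p : Ambient (m + 1)), K (φ p)⟫ = 0 := by
    have h := hK (φ p) (φ p)
    rw [real_inner_comm, ← two_mul] at h
    simpa using h
  rw [divergence_eq_sum_inner hφ (contMDiff_dmap_hypCurrent hφ hν hK hKX),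
    inner_bitension hφ hν p hxK, ← Finset.sum_neg_distrib]
  simp_rw [dmap_hypCurrent hφ hν hK hKX]
  -- Both sides are sums over the same frame and agree term by term.
  refine Finset.sum_congr rfl fun i _ => ?_
  have hF := (hφ.contMDiff_coe p).mdifferentiableAt (by simp)
  have hN := (hν.smooth p).mdifferentiableAt (by simp)
  have hH := (contMDiff_traceShape hφ hν p).mdifferentiableAt (by simp)
  have hB := (contMDiff_ambientShape hφ hν p).mdifferentiableAt (by simp)
  have hG := (contMDiff_traceShapeGrad hφ hν p).mdifferentiableAt (by simp)
  have hKF : MDifferentiableAt (𝓡 m) 𝓘(ℝ, Ambient (m + 1)) (fun q => K (φ q)) p :=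
    K.differentiableAt.comp_mdifferentiableAt hF
  have hKN : MDifferentiableAt (𝓡 m) 𝓘(ℝ, Ambient (m + 1)) (fun q => K (ν q)) p :=
    K.differentiableAt.comp_mdifferentiableAt hN
  have hh : MDifferentiableAt (𝓡 m) 𝓘(ℝ, ℝ) (fun q => ⟪K (φ q), ν q⟫) p :=
    (contMDiff_inner (K.contDiff.contMDiff.comp hφ.contMDiff_coe) hν.smooth p).mdifferentiableAt
      (by simp)
  have hBK := hB.clm_apply hKF
  have hhF : MDifferentiableAt (𝓡 m) 𝓘(ℝ, Ambient (m + 1))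
    (fun q => ⟪K (φ q), ν q⟫ • (φ q : Ambient (m + 1))) p := hh.smul hF
  have hBKN : MDifferentiableAt (𝓡 m) 𝓘(ℝ, Ambient (m + 1))
    (fun q => ambientShape φ ν q (K (φ q)) - K (ν q)) p := hBK.sub hKN
  have hZ : MDifferentiableAt (𝓡 m) 𝓘(ℝ, Ambient (m + 1)) (fun q => ambientShape φ ν q (K (φ q)) -
    K (ν q) - ⟪K (φ q), ν q⟫ • (φ q : Ambient (m + 1))) p := hBKN.sub hhF
  have hHZ : MDifferentiableAt (𝓡 m) 𝓘(ℝ, Ambient (m + 1)) (fun q => traceShape φ ν q •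
    (ambientShape φ ν q (K (φ q)) - K (ν q) -
      ⟪K (φ q), ν q⟫ • (φ q : Ambient (m + 1)))) p := hH.smul hZ
  have hhG : MDifferentiableAt (𝓡 m) 𝓘(ℝ, Ambient (m + 1))
    (fun q => ⟪K (φ q), ν q⟫ • traceShapeGrad φ ν q) p := hh.smul hG
  have h1 : mvfderiv (𝓡 m) (fun q => (φ q : Ambient (m + 1))) p (onb p i) = dmap φ p (onb p i) :=
    rfl
  have h2 : mvfderiv (𝓡 m) (traceShape φ ν) p (onb p i) =
      traceShapeDeriv φ ν p (dmap φ p (onb p i)) := (tangentialDeriv_dmap hφ _ _ _).symm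
  have h3 : mvfderiv (𝓡 m) ν p (onb p i) = -ambientShape φ ν p (dmap φ p (onb p i)) := by
    rw [ambientShape_dmap hφ, neg_neg]
  rw [mvfderiv_fun_sub hHZ hhG, sub_apply, mvfderiv_smul_apply hH hZ, mvfderiv_smul_apply hh hG,
    mvfderiv_fun_sub hBKN hhF, sub_apply, mvfderiv_fun_sub hBK hKN, sub_apply,
    mvfderiv_clm_apply hB hKF, mvfderiv_smul_apply hh hF, mvfderiv_inner hKF hN,
    mvfderiv_comp_left K.hasFDerivAt hF, mvfderiv_comp_left K.hasFDerivAt hN, h1, h2, h3]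
  generalize ht : dmap φ p (onb p i) = t
  have htt : ⟪t, t⟫ = 1 := by
    rw [← ht, hφ.isometric, real_inner_self_eq_norm_sq, (onb p).norm_eq_one]; norm_num
  have hxt : ⟪(φ p : Ambient (m + 1)), t⟫ = 0 := by rw [← ht, inner_coe_dmap hφ]
  have e1 := hK (ambientShape φ ν p t) t
  have e2 := inner_ambientShape_comm hφ hν p (K t) t
  have e3 := inner_ambientShape_comm hφ hν p (K (φ p)) t
  have e4 := mvfderiv_ambientShape_comm hφ hν p (onb p i) (K (φ p)) t
  have e5 := hK t (ν p)
  simp only [inner_sub_left, inner_add_left, real_inner_smul_left, map_neg, inner_neg_left,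
    inner_neg_right, inner_mvfderiv_traceShapeGrad hφ hν, inner_traceShapeGrad, htt, hxt]
  rw [real_inner_comm (K t)] at e1
  rw [real_inner_comm (K (ν p)) t] at e5
  rw [real_inner_comm (K (φ p)) (ν p), e4, e3, e2, real_inner_comm (K (φ p)) (ambientShape _ _ _ _),
    real_inner_comm (K (φ p)) (mvfderiv (𝓡 m) (ambientShape φ ν) p (onb p i) t)]
  -- Skewness of K removes what is left: `e1` cancels H(⟨KBt, t⟩ + ⟨Bt, Kt⟩), and `e5` cancels
  -- dH(t)(⟨Kt, ν⟩ + ⟨t, Kν⟩).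
  linear_combination (traceShape φ ν p) * e1 - (traceShapeDeriv φ ν p t) * e5

end Killing

end Current

end BiharmonicHypersurface

end

open BiharmonicHypersurface in
theorem mainTheorem4 {m : ℕ} {M : Type*} [TopologicalSpace M]
    [ChartedSpace (EuclideanSpace ℝ (Fin m)) M] [IsManifold (𝓡 m) ∞ M]
    [RiemannianBundle (fun p : M => TangentSpace (𝓡 m) p)]
    [IsContMDiffRiemannianBundle (𝓡 m) ∞ (EuclideanSpace ℝ (Fin m))
      (fun p : M => TangentSpace (𝓡 m) p)]
    (φ : M → Sph (m + 1)) (hφ : IsBiharmonicHypersurface φ)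
    (ν : M → Ambient (m + 1)) (hν : IsUnitNormal φ ν)
    (X : ∀ x : Sph (m + 1), TangentSpace (𝓡 (m + 1)) x) (hX : IsKilling X) :
    ContMDiff (𝓡 m) (𝓡 m).tangent ∞
        (fun p => (⟨p, hypCurrent φ ν X p⟩ : TangentBundle (𝓡 m) M)) ∧
      ∀ p : M, divergence (hypCurrent φ ν X) p = 0 := by
  have hi := hφ.toIsIsometricImmersion
  obtain ⟨K, hK, hKX⟩ := hX.exists_skew (Nat.le_add_left 1 m)
  refine ⟨contMDiff_section_of_dmap hi (contMDiff_dmap_hypCurrent hi hν hK hKX), fun p => ?_⟩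
  rw [divergence_hypCurrent hi hν hK hKX, hφ.biharmonic, inner_zero_left, neg_zero]
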